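/- **Setting.** $M\ge1$ agents act in a Markov decision process with state space $\mathcal S$, joint action space $\mathcal A$, transition kernel $\mathcal P(\cdot|s,a)$, discount factor $\gamma\in[0,1)$, rewards $R^{(m)}(s,a,s')\in[0,R_{\max}]$ ($m=1,\dots,M$, $R_{\max}>0$), joint policies $\pi_\omega(\cdot|s)$ with parameter $\omega\in\Omega$, and features $\phi(s)\in\mathbb R^d$ with $\|\phi(s)\|\le1$. Assume: (a) for every $\omega$ the state chain induced by $\mathcal P$ and $\pi_\omega$ has a stationary distribution $\mu_\omega$ and $\sup_{s}d_{\mathrm{TV}}\big(\mathbb P(s_t\in\cdot\,|\,s_0=s),\mu_\omega\big)\le\kappa\rho^t$ for all $t\ge0$, with constants $\kappa>0$, $\rho\in(0,1)$ independent of $\omega$, where $d_{\mathrm{TV}}(p,q)=\sup_E|p(E)-q(E)|$; (b) $\lambda_{\min}\big(\mathbb E_{s\sim\mu_\omega}[\phi(s)\phi(s)^\top]\big)\ge\lambda_\phi>0$ for every $\omega$; (c) $W\in\mathbb R^{M\times M}$ is doubly stochastic with second largest singular value $\sigma_W<1$ ($\sigma_W=0$ if $M=1$). Put $B_\omega=\mathbb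 E\big[\phi(s)(\gamma\phi(s')-\phi(s))^\top\big]$ and $b_\omega=\mathbb E\big[\frac1M\sum_mR^{(m)}(s,a,s')\,\phi(s)\big]$ with $s\sim\mu_\omega$, $a\sim\pi_\omega(\cdot|s)$, $s'\sim\mathcal P(\cdot|s,a)$, and let $\theta^*_\omega=-B_\omega^{-1}b_\omega$. **Algorithm (decentralized mini-batch TD).** Let $\omega_t$ be a (possibly random) policy parameter and $s_0,a_0,s_1,a_1,\dots$ Markovian samples, $a_i\sim\pi_{\omega_t}(\cdot|s_i)$, $s_{i+1}\sim\mathcal P(\cdot|s_i,a_i)$, where $\omega_t$ and $s_0$ are arbitrary random variables known at time $0$. Starting from $\theta_0^{(m)}=\theta_{-1}$ for all $m$, where $\theta_{-1}\in\mathbb R^d$ is fixed, put $$\theta^{(m)}_{t'+1}=\sum_{m'}W_{m,m'}\theta^{(m')}_{t'}+\frac{\beta}{N_c}\sum_{i=t'N_c}^{(t'+1)N_c-1}\big[R^{(m)}(s_i,a_i,s_{i+1})+\gamma\phi(s_{i+1})^\top\theta^{(m)}_{t'}-\phi(s_i)^\top\theta^{(m)}_{t'}\big]\phi(s_i)$$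 for $0\le t'<T_c$, and $\theta^{(m)}_{t'+1}=\sum_{m'}W_{m,m'}\theta^{(m')}_{t'}$ for $T_c\le t'<T_c+T_c'$. **Constants.** $C_B=1+\gamma$, $C_b=R_{\max}$, $\lambda_B=2(1-\gamma)\lambda_\phi$, $R_\theta=2C_b/\lambda_B$, $$c_1=\frac{1920\,(C_B^2R_\theta^2+C_b^2)[1+(\kappa-1)\rho]}{(1-\rho)\lambda_B^2},\qquad c_2=2\Big(\frac{2MC_b}{1-\sigma_W}\Big)^2,\qquad c_3=2\big(\|\theta_{-1}\|^2+R_\theta^2\big).$$ **Claim.** Suppose $0<\beta\le\min\big(\frac{\lambda_B}{8C_B^2},\frac4{\lambda_B},\frac{1-\sigma_W}{2C_B}\big)$. If $N_c\ge\big(\frac2{\lambda_B}+2\beta\big)\frac{192\,C_B^2[1+(\kappa-1)\rho]}{(1-\rho)\lambda_B}$, then, almost surely, for all $T_c,T_c'\ge0$, $$\sum_{m=1}^M\mathbb E\big[\|\theta^{(m)}_{T_c+T_c'}-\theta^*_{\omega_t}\|^2\,\big|\,\omega_t\big]\le\sigma_W^{2T_c'}\beta^2c_2+2M\Big[c_3\Big(1-\frac{\lambda_B}8\beta\Big)^{T_c}+\frac{c_1}{N_c}\Big]$$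 (the squared errors being integrable). Moreover, for every $\epsilon>0$ one can choose $N_c$ satisfying the condition above, $T_c$ and $T_c'$, independently of the samples, such that $\sum_{m=1}^M\mathbb E\big[\|\theta^{(m)}_{T_c+T_c'}-\theta^*_{\omega_t}\|^2\,\big|\,\omega_t\big]\le\epsilon$ almost surely and, as $\epsilon\to0^+$, $N_c=\mathcal O(\epsilon^{-1})$ and $T_c,T_c'=\mathcal O(\ln\epsilon^{-1})$. Hence the sample complexity is $T_cN_c=\mathcal O(\epsilon^{-1}\ln\epsilon^{-1})$ and the number of communication rounds is $T_c+T_c'=\mathcal O(\ln\epsilon^{-1})$. -/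

import Mathlib

open MeasureTheory ProbabilityTheory Filter Topology

noncomputable section

namespace DecTD

/-- The data of a multi-agent Markov decision process with `M` agents, state space `S`, joint action
space `A`, a family of joint policies indexed by the policy parameter `ω : Ω`, one reward function
for each agent, and the `d`-dimensional state features used by the critics. -/
structure MultiAgentMDP (M d : ℕ) (S A Ω : Type*) [MeasurableSpace S] [MeasurableSpace A]
    [MeasurableSpace Ω] where
  /-- the transition kernel `P(· | s, a)` -/
  transition : Kernel (S × A) S
  /-- the joint policy `π_ω(· | s)` -/
  policy : Kernel (Ω × S) A
  /-- the reward `R⁽ᵐ⁾(s, a, s')` of agent `m` -/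
  reward : Fin M → S → A → S → ℝ
  /-- the feature vector `φ(s)` -/
  feature : S → EuclideanSpace ℝ (Fin d)
  isMarkovKernel_transition : IsMarkovKernel transition
  isMarkovKernel_policy : IsMarkovKernel policy
  measurable_reward : ∀ m, Measurable fun z : S × A × S => reward m z.1 z.2.1 z.2.2
  measurable_feature : Measurable feature

attribute [instance] MultiAgentMDP.isMarkovKernel_transition MultiAgentMDP.isMarkovKernel_policy

/-- The total variation distance `sup_E |μ(E) - ν(E)|`, over measurable events `E`. -/
def dTV {X : Type*} [MeasurableSpace X] (μ ν : Measure X) : ℝ :=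
  ⨆ E : {E : Set X // MeasurableSet E}, |μ.real E - ν.real E|

/-- The second largest singular value of a square matrix (`0` for a `1 × 1` matrix). -/
def sigmaW {M : ℕ} (W : Matrix (Fin M) (Fin M) ℝ) : ℝ :=
  (Matrix.toEuclideanLin W).singularValues 1

namespace MultiAgentMDP

variable {M d : ℕ} {S A Ω : Type*} [MeasurableSpace S] [MeasurableSpace A] [MeasurableSpace Ω]
  (mdp : MultiAgentMDP M d S A Ω)

/-- One step of the environment: from `(ω, s)` draw `a ∼ π_ω(· | s)`, then `s' ∼ P(· | s, a)`;
the result is the pair `(a, s')`. -/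
def step : Kernel (Ω × S) (A × S) :=
  mdp.policy ⊗ₖ mdp.transition.comap (fun z : (Ω × S) × A => (z.1.2, z.2)) (by fun_prop)

/-- The transition kernel of the state chain `(s_i)` under the policy `π_ω`. -/
def stateKernel (ω : Ω) : Kernel S S :=
  Kernel.snd (mdp.step.comap (fun s : S => (ω, s)) (by fun_prop))

/-- The law of `(s, a, s')` with `s ∼ μ`, `a ∼ π_ω(· | s)`, `s' ∼ P(· | s, a)`. -/
def sampleLaw (μ : Measure S) (ω : Ω) : Measure (S × A × S) :=
  μ ⊗ₘ mdp.step.comap (fun s : S => (ω, s)) (by fun_prop)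

/-- The matrix `E_{s ∼ μ} [φ(s) φ(s)ᵀ]`. -/
def featureCov (μ : Measure S) : Matrix (Fin d) (Fin d) ℝ :=
  Matrix.of fun i j => ∫ s, mdp.feature s i * mdp.feature s j ∂μ

/-- `B_ω = E [φ(s) (γ φ(s') - φ(s))ᵀ]`. -/
def tdMatrix (γ : ℝ) (μ : Measure S) (ω : Ω) : Matrix (Fin d) (Fin d) ℝ :=
  Matrix.of fun i j =>
    ∫ z, mdp.feature z.1 i * (γ * mdp.feature z.2.2 j - mdp.feature z.1 j) ∂(mdp.sampleLaw μ ω)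

/-- `b_ω = E [R̄(s, a, s') φ(s)]`, where `R̄` is the average of the rewards of the agents. -/
def tdVector (μ : Measure S) (ω : Ω) : Fin d → ℝ :=
  fun i => ∫ z, ((1 / (M : ℝ)) * ∑ m, mdp.reward m z.1 z.2.1 z.2.2) * mdp.feature z.1 i
    ∂(mdp.sampleLaw μ ω)

/-- The optimal critic parameter `θ*_ω`, the root of `B_ω θ + b_ω = 0`. -/
def optimalCritic (γ : ℝ) (μ : Measure S) (ω : Ω) : EuclideanSpace ℝ (Fin d) :=
  WithLp.toLp 2 (-((mdp.tdMatrix γ μ ω)⁻¹.mulVec (mdp.tdVector μ ω)))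

/-- The assumptions on the environment: for every `ω`, the measure `μ ω` is a stationary state
distribution of the chain with policy `π_ω`, to which that chain converges geometrically in total
variation, uniformly in the starting state; the rewards lie in `[0, Rmax]`; the features have norm
at most one, and the smallest eigenvalue of `E_{s ∼ μ ω} [φ(s) φ(s)ᵀ]` is at least `lamPhi`. -/
structure Assumptions (μ : Ω → Measure S) (κ ρ Rmax lamPhi : ℝ) : Prop where
  isProbabilityMeasure : ∀ ω, IsProbabilityMeasure (μ ω)
  stationary : ∀ ω, (mdp.stateKernel ω).Invariant (μ ω)
  mixing : ∀ ω (t : ℕ) (s : S), dTV ((mdp.stateKernel ω ^ t) s) (μ ω) ≤ κ * ρ ^ t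
  reward_nonneg : ∀ m s a s', 0 ≤ mdp.reward m s a s'
  reward_le : ∀ m s a s', mdp.reward m s a s' ≤ Rmax
  feature_norm_le : ∀ s, ‖mdp.feature s‖ ≤ 1
  le_eigenvalue : ∀ (ω : Ω) (x : ℝ),
    Module.End.HasEigenvalue (Matrix.toLin' (mdp.featureCov (μ ω))) x → lamPhi ≤ x

/-- The critic parameters `θ_{t'}⁽ᵐ⁾` of decentralized mini-batch TD, run along the sample path
`s 0, a 0, s 1, a 1, …`, from the common initial value `θinit`.  Each of the first `Tc` iterations
averages over the neighbours with the weights `W` and adds a TD step of size `β` on a fresh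
mini-batch of `Nc` consecutive transitions; all further iterations only average. -/
def critic (γ : ℝ) (W : Matrix (Fin M) (Fin M) ℝ) (β : ℝ) (Nc Tc : ℕ)
    (θinit : EuclideanSpace ℝ (Fin d)) (s : ℕ → S) (a : ℕ → A) :
    ℕ → Fin M → EuclideanSpace ℝ (Fin d)
  | 0 => fun _ => θinit
  | t + 1 => fun m =>
    let θ := critic γ W β Nc Tc θinit s a t
    if t < Tc then
      ∑ m', W m m' • θ m' + (β / (Nc : ℝ)) • ∑ i ∈ Finset.Ico (t * Nc) ((t + 1) * Nc),
        (mdp.reward m (s i) (a i) (s (i + 1)) + γ * inner ℝ (mdp.feature (s (i + 1))) (θ m)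
          - inner ℝ (mdp.feature (s i)) (θ m)) • mdp.feature (s i)
    else ∑ m', W m m' • θ m'

/-- The Markovian samples: on a probability space with filtration `𝓕`, the policy parameter `ω` and
the starting state `s 0` are known at time `0`, and given the information `𝓕 i` at time `i`, the
pair `(a i, s (i+1))` is drawn as `a i ∼ π_ω(· | s i)`, `s (i+1) ∼ P(· | s i, a i)`. -/
structure IsMarkovianSample {Ω₀ : Type*} {m₀ : MeasurableSpace Ω₀} (Pr : Measure Ω₀)
    (𝓕 : Filtration ℕ m₀) (ω : Ω₀ → Ω) (s : ℕ → Ω₀ → S) (a : ℕ → Ω₀ → A) : Prop where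
  measurable_param : Measurable[𝓕 0] ω
  measurable_state : ∀ i, Measurable[𝓕 i] (s i)
  measurable_action : ∀ i, Measurable[𝓕 (i + 1)] (a i)
  condLaw : ∀ (i : ℕ) (E : Set (A × S)), MeasurableSet E →
    Pr[({x | (a i x, s (i + 1) x) ∈ E}).indicator (fun _ => (1 : ℝ)) | 𝓕 i]
      =ᵐ[Pr] fun x => (mdp.step (ω x, s i x)).real E

/-- The squared error `‖θ⁽ᵐ⁾_{Tc + Tc'} - θ*_ω‖²` of agent `m` at the end of decentralized TD. -/
def sqError (γ : ℝ) (μ : Ω → Measure S) (W : Matrix (Fin M) (Fin M) ℝ) (β : ℝ) (Nc Tc Tc' : ℕ)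
    (θinit : EuclideanSpace ℝ (Fin d)) {Ω₀ : Type*} (ω : Ω₀ → Ω) (s : ℕ → Ω₀ → S)
    (a : ℕ → Ω₀ → A) (m : Fin M) : Ω₀ → ℝ :=
  fun x => ‖mdp.critic γ W β Nc Tc θinit (fun i => s i x) (fun i => a i x) (Tc + Tc') m
    - mdp.optimalCritic γ (μ (ω x)) (ω x)‖ ^ 2

end MultiAgentMDP

/-- `C_B = 1 + γ`. -/
def CB (γ : ℝ) : ℝ := 1 + γ

/-- `λ_B = 2 (1 - γ) λ_φ`. -/
def lamB (γ lamPhi : ℝ) : ℝ := 2 * (1 - γ) * lamPhi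

/-- `R_θ = 2 C_b / λ_B`, where `C_b = Rmax`. -/
def Rtheta (γ lamPhi Rmax : ℝ) : ℝ := 2 * Rmax / lamB γ lamPhi

/-- `c₁ = 1920 (C_B² R_θ² + C_b²) [1 + (κ - 1) ρ] / ((1 - ρ) λ_B²)`. -/
def c1 (γ κ ρ lamPhi Rmax : ℝ) : ℝ :=
  1920 * (CB γ ^ 2 * Rtheta γ lamPhi Rmax ^ 2 + Rmax ^ 2) * (1 + (κ - 1) * ρ)
    / ((1 - ρ) * lamB γ lamPhi ^ 2)

/-- `c₂ = 2 (2 M C_b / (1 - σ_W))²`. -/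
def c2 (M : ℕ) (σ Rmax : ℝ) : ℝ := 2 * (2 * M * Rmax / (1 - σ)) ^ 2

/-- `c₃ = 2 (r² + R_θ²)`, where `r = ‖θ₋₁‖` is the norm of the initial critic parameter. -/
def c3 (γ lamPhi Rmax r : ℝ) : ℝ := 2 * (r ^ 2 + Rtheta γ lamPhi Rmax ^ 2)

/-- The largest admissible step size. -/
def betaMax (γ lamPhi σ : ℝ) : ℝ :=
  min (lamB γ lamPhi / (8 * CB γ ^ 2)) (min (4 / lamB γ lamPhi) ((1 - σ) / (2 * CB γ)))

/-- The smallest admissible batch size. -/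
def batchMin (γ κ ρ lamPhi β : ℝ) : ℝ :=
  (2 / lamB γ lamPhi + 2 * β) *
    (192 * CB γ ^ 2 * (1 + (κ - 1) * ρ) / ((1 - ρ) * lamB γ lamPhi))

end DecTD

end

/-! Each critic splits into the average over the agents and a deviation from it. Since `W` is doubly
stochastic, mixing leaves the average unchanged; since all agents share the features and the TD
direction is affine in θ, the average itself runs centralized mini-batch TD with the averaged reward
(`meanCritic_succ_of_lt`).

Deviations sum to zero, so mixing shrinks them by σ_W (`norm_sq_toEuclideanLin_le`). A TD step adds
at most βC_B times the deviation plus √M·βR_max from the disagreement of the rewards. When βC_B ≤ (1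
- σ_W)/2 they stay of order β, and the last T_c' rounds multiply them by σ_W^{T_c'}
(`sum_norm_sq_critic_sub_meanCritic_le`).

For the average, the stationary TD field is strongly monotone (`inner_integral_tdLinear_le`): s and
s' have the same law under μ_ω, so the discounted cross term costs only a factor γ of the quadratic
form. One step therefore contracts the squared error by 1 - λ_Bβ/2, up to the batch noise
(`norm_sq_add_smul_le`). Noises at lag n have correlation of order κρⁿ, so the second moment of a
batch mean is of order 1/N_c times E(C_B‖θ‖ + R_max)² (`IsPath.integral_norm_sq_batch_le`). Without
a projection ‖θ‖ is controlled only through the error itself; the lower bound on N_c lets this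
feedback consume at most three quarters of the contraction, which leaves the rate 1 - λ_Bβ/8 and the
floor c₁/N_c (`contraction_of_batch`).

Conditioning on ω is replaced by restricting the probability to an event F of σ(ω): the path
property survives (`IsMarkovianSample.isPath_restrict`), and bounds B·P(F) for all such F amount to
the almost sure bound B on the conditional expectation (`condExp_le_const_of_setIntegral_le`). -/

noncomputable section

namespace DecTD

/-! ### Contraction by the mixing matrix on vectors of sum zero. -/

/-- A doubly stochastic matrix with second singular value below one contracts, by that singular
value, every vector whose coordinates sum to zero. -/
theorem norm_sq_toEuclideanLin_le {M : ℕ} {W : Matrix (Fin M) (Fin M) ℝ}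
    (hW : W ∈ doublyStochastic ℝ (Fin M)) (hσ : sigmaW W < 1)
    (v : EuclideanSpace ℝ (Fin M)) (hv : ∑ m, v m = 0) :
    ‖Matrix.toEuclideanLin W v‖ ^ 2 ≤ sigmaW W ^ 2 * ‖v‖ ^ 2 := by
  rcases Nat.eq_zero_or_pos M with rfl | hM
  · simp [Subsingleton.elim v 0]
  obtain ⟨-, hrow, hcol⟩ := mem_doublyStochastic_iff_sum.1 hW
  set T := Matrix.toEuclideanLin W with hT
  have hn : Module.finrank ℝ (EuclideanSpace ℝ (Fin M)) = M := by simp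
  set A := LinearMap.adjoint T ∘ₗ T with hA
  have hsym : A.IsSymmetric := T.isSymmetric_adjoint_comp_self
  set one : EuclideanSpace ℝ (Fin M) := WithLp.toLp 2 1 with hone
  have hT1 : T one = one := by
    ext i
    simpa [hT, hone, Matrix.toLpLin_apply, Matrix.mulVec, dotProduct] using hrow i
  have hT1' : LinearMap.adjoint T one = one := by
    rw [hT, ← Matrix.toEuclideanLin_conjTranspose_eq_adjoint]
    ext i
    simpa [hone, Matrix.toLpLin_apply, Matrix.mulVec, dotProduct] using hcol i
  have hA1 : A one = one := by simp [hA, hT1, hT1']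
  set u := hsym.eigenvectorBasis hn with hu
  have hAu : ∀ i, A (u i) = hsym.eigenvalues hn i • u i := fun i =>
    hsym.apply_eigenvectorBasis hn i
  -- Eigenvalues of `A` come in decreasing order and singular values are indexed from 0, so every
  -- index except 0 is dominated by the second singular value.
  have hev : ∀ i : Fin M, i ≠ ⟨0, hM⟩ → hsym.eigenvalues hn i ≤ sigmaW W ^ 2 := by
    intro i hi
    have h1 : 1 ≤ (i : ℕ) := Nat.one_le_iff_ne_zero.2 fun h => hi (Fin.ext h)
    have h := T.sq_singularValues_fin hn i
    rw [← h]
    exact pow_le_pow_left₀ (T.singularValues_nonneg _) (T.singularValues_antitone h1) 2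
  have hσ0 : 0 ≤ sigmaW W := T.singularValues_nonneg _
  -- The all-ones vector is fixed by `A`, hence orthogonal to eigenvectors with eigenvalue below 1.
  have horth : ∀ i : Fin M, i ≠ ⟨0, hM⟩ → inner ℝ (u i) one = 0 := by
    intro i hi
    have h1 : inner ℝ (A (u i)) one = inner ℝ (u i) (A one) := hsym _ _
    rw [hAu, hA1, real_inner_smul_left] at h1
    have h2 : hsym.eigenvalues hn i < 1 := (hev i hi).trans_lt (by nlinarith)
    have h3 : (hsym.eigenvalues hn i - 1) * inner ℝ (u i) one = 0 := by linarith
    exact (mul_eq_zero.1 h3).resolve_left (by linarith)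
  have hone0 : one ≠ 0 := fun h => by
    have := congrArg (fun w : EuclideanSpace ℝ (Fin M) => w ⟨0, hM⟩) h
    simp [hone] at this
  have hu0 : inner ℝ (u ⟨0, hM⟩) one ≠ 0 := by
    intro h
    apply hone0
    apply InnerProductSpace.ext_inner_left_basis u.toBasis
    intro i
    by_cases hi : i = ⟨0, hM⟩
    · simpa [hi] using h
    · simpa using horth i hi
  have hv1 : inner ℝ v one = 0 := by
    simpa [hone, PiLp.inner_apply] using hv
  -- In the eigenbasis the all-ones vector has only its component along `u 0`, so orthogonality to
  -- it is orthogonality to `u 0`: the one direction that need not contract is absent from `v`.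
  have hvu : inner ℝ v (u ⟨0, hM⟩) = 0 := by
    rw [← u.sum_inner_mul_inner v one, Finset.sum_eq_single ⟨0, hM⟩
      (fun i _ hi => by rw [horth i hi, mul_zero]) (by simp)] at hv1
    exact (mul_eq_zero.1 hv1).resolve_right hu0
  have h1 : ‖T v‖ ^ 2 = ∑ i, hsym.eigenvalues hn i * inner ℝ v (u i) ^ 2 := by
    rw [← real_inner_self_eq_norm_sq, ← LinearMap.adjoint_inner_right]
    change inner ℝ v (A v) = _
    rw [← u.sum_inner_mul_inner v (A v)]
    refine Finset.sum_congr rfl fun i _ => ?_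
    rw [← hsym (u i) v, hAu, real_inner_smul_left, real_inner_comm v (u i)]
    ring
  have h2 : ‖v‖ ^ 2 = ∑ i, inner ℝ v (u i) ^ 2 := by
    rw [← real_inner_self_eq_norm_sq, ← u.sum_inner_mul_inner v v]
    refine Finset.sum_congr rfl fun i _ => ?_
    rw [real_inner_comm v (u i)]
    ring
  rw [h1, h2, Finset.mul_sum]
  refine Finset.sum_le_sum fun i _ => ?_
  by_cases hi : i = ⟨0, hM⟩
  · rw [hi, hvu]; simp
  · exact mul_le_mul_of_nonneg_right (hev i hi) (sq_nonneg _)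

/-- The vector-valued form of `norm_sq_toEuclideanLin_le`. -/
theorem sum_norm_sq_mix_le {M d : ℕ} {W : Matrix (Fin M) (Fin M) ℝ}
    (hW : W ∈ doublyStochastic ℝ (Fin M)) (hσ : sigmaW W < 1)
    (δ : Fin M → EuclideanSpace ℝ (Fin d)) (hδ : ∑ m, δ m = 0) :
    ∑ m, ‖∑ m', W m m' • δ m'‖ ^ 2 ≤ sigmaW W ^ 2 * ∑ m, ‖δ m‖ ^ 2 := by
  have h : ∀ k : Fin d, ∑ m, (∑ m', W m m' * δ m' k) ^ 2 ≤ sigmaW W ^ 2 * ∑ m, δ m k ^ 2 := by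
    intro k
    have := norm_sq_toEuclideanLin_le hW hσ (WithLp.toLp 2 fun m => δ m k) (by
      simpa using congrArg (fun w : EuclideanSpace ℝ (Fin d) => w k) hδ)
    simpa [EuclideanSpace.norm_sq_eq, Matrix.toLpLin_apply, Matrix.mulVec, dotProduct] using this
  calc ∑ m, ‖∑ m', W m m' • δ m'‖ ^ 2 = ∑ k, ∑ m, (∑ m', W m m' * δ m' k) ^ 2 := by
        rw [Finset.sum_comm]
        simp [EuclideanSpace.norm_sq_eq]
    _ ≤ ∑ k, sigmaW W ^ 2 * ∑ m, δ m k ^ 2 := Finset.sum_le_sum fun k _ => h k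
    _ = sigmaW W ^ 2 * ∑ m, ‖δ m‖ ^ 2 := by
        rw [← Finset.mul_sum, Finset.sum_comm]
        simp [EuclideanSpace.norm_sq_eq]

section Norm

variable {M d : ℕ}

theorem norm_toLp_le_mul {f g : Fin M → EuclideanSpace ℝ (Fin d)} {c : ℝ} (hc : 0 ≤ c)
    (h : ∀ m, ‖f m‖ ≤ c * ‖g m‖) : ‖WithLp.toLp 2 f‖ ≤ c * ‖WithLp.toLp 2 g‖ := by
  refine le_of_sq_le_sq ?_ (by positivity)
  rw [mul_pow, PiLp.norm_sq_eq_of_L2, PiLp.norm_sq_eq_of_L2, Finset.mul_sum]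
  refine Finset.sum_le_sum fun m _ => ?_
  rw [← mul_pow]
  exact pow_le_pow_left₀ (norm_nonneg _) (h m) 2

theorem norm_toLp_le_sqrt_mul {f : Fin M → EuclideanSpace ℝ (Fin d)} {c : ℝ} (hc : 0 ≤ c)
    (h : ∀ m, ‖f m‖ ≤ c) : ‖WithLp.toLp 2 f‖ ≤ √M * c := by
  refine le_of_sq_le_sq ?_ (by positivity)
  rw [mul_pow, PiLp.norm_sq_eq_of_L2, Real.sq_sqrt (by positivity)]
  calc ∑ m, ‖f m‖ ^ 2 ≤ ∑ _m : Fin M, c ^ 2 :=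
        Finset.sum_le_sum fun m _ => pow_le_pow_left₀ (norm_nonneg _) (h m) 2
    _ = M * c ^ 2 := by simp

theorem norm_smul_sum_Ico_le {E : Type*} [NormedAddCommGroup E] [NormedSpace ℝ E] {β c : ℝ}
    (hβ : 0 ≤ β) (hc : 0 ≤ c) (N t : ℕ) (f : ℕ → E) (h : ∀ i, ‖f i‖ ≤ c) :
    ‖(β / (N : ℝ)) • ∑ i ∈ Finset.Ico (t * N) ((t + 1) * N), f i‖ ≤ β * c := by
  have h1 : ‖∑ i ∈ Finset.Ico (t * N) ((t + 1) * N), f i‖ ≤ N * c := by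
    refine (norm_sum_le_of_le _ fun i _ => h i).trans_eq ?_
    simp [Nat.add_mul]
  rw [norm_smul, Real.norm_of_nonneg (by positivity)]
  rcases Nat.eq_zero_or_pos N with rfl | hN
  · simp only [Nat.cast_zero, div_zero, zero_mul]; positivity
  · calc β / N * ‖∑ i ∈ Finset.Ico (t * N) ((t + 1) * N), f i‖ ≤ β / N * (N * c) := by gcongr
      _ = β * c := by field_simp

end Norm

/-! ### The averaged critic and the consensus error. -/

namespace MultiAgentMDP

variable {M d : ℕ} {S A Ω : Type*} [MeasurableSpace S] [MeasurableSpace A] [MeasurableSpace Ω]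
  (mdp : MultiAgentMDP M d S A Ω)

/-- The reward averaged over the agents. -/
def meanReward (z : S × A × S) : ℝ := (1 / (M : ℝ)) * ∑ m, mdp.reward m z.1 z.2.1 z.2.2

/-- The linear part of the temporal-difference direction. -/
def tdLinear (γ : ℝ) (θ : EuclideanSpace ℝ (Fin d)) (z : S × A × S) :
    EuclideanSpace ℝ (Fin d) :=
  (γ * inner ℝ (mdp.feature z.2.2) θ - inner ℝ (mdp.feature z.1) θ) • mdp.feature z.1

/-- The temporal-difference direction for the averaged reward. -/
def tdField (γ : ℝ) (θ : EuclideanSpace ℝ (Fin d)) (z : S × A × S) :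
    EuclideanSpace ℝ (Fin d) :=
  mdp.meanReward z • mdp.feature z.1 + mdp.tdLinear γ θ z

/-- The average of the critic parameters of the agents. -/
def meanCritic (γ : ℝ) (W : Matrix (Fin M) (Fin M) ℝ) (β : ℝ) (Nc Tc : ℕ)
    (θinit : EuclideanSpace ℝ (Fin d)) (s : ℕ → S) (a : ℕ → A) (t : ℕ) :
    EuclideanSpace ℝ (Fin d) :=
  (1 / (M : ℝ)) • ∑ m, mdp.critic γ W β Nc Tc θinit s a t m

variable {mdp} {γ β : ℝ} {W : Matrix (Fin M) (Fin M) ℝ} {Nc Tc : ℕ}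
  {θinit : EuclideanSpace ℝ (Fin d)} {s : ℕ → S} {a : ℕ → A}

theorem critic_succ_of_lt {t : ℕ} (ht : t < Tc) (m : Fin M) :
    mdp.critic γ W β Nc Tc θinit s a (t + 1) m =
      ∑ m', W m m' • mdp.critic γ W β Nc Tc θinit s a t m' +
        (β / (Nc : ℝ)) • ∑ i ∈ Finset.Ico (t * Nc) ((t + 1) * Nc),
          (mdp.reward m (s i) (a i) (s (i + 1)) • mdp.feature (s i) +
            mdp.tdLinear γ (mdp.critic γ W β Nc Tc θinit s a t m) (s i, a i, s (i + 1))) := by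
  simp only [critic, if_pos ht, tdLinear, ← add_smul, add_sub_assoc]

theorem critic_succ_of_le {t : ℕ} (ht : Tc ≤ t) (m : Fin M) :
    mdp.critic γ W β Nc Tc θinit s a (t + 1) m =
      ∑ m', W m m' • mdp.critic γ W β Nc Tc θinit s a t m' := by
  simp only [critic, if_neg ht.not_gt]

theorem tdLinear_sum_smul {ι : Type*} (I : Finset ι) (c : ℝ)
    (θ : ι → EuclideanSpace ℝ (Fin d)) (z : S × A × S) :
    mdp.tdLinear γ (c • ∑ m ∈ I, θ m) z = c • ∑ m ∈ I, mdp.tdLinear γ (θ m) z := by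
  simp only [tdLinear, inner_smul_right, inner_sum, ← Finset.sum_smul, smul_smul,
    Finset.sum_sub_distrib, ← Finset.mul_sum]
  congr 1
  ring

theorem tdLinear_sub (θ θ' : EuclideanSpace ℝ (Fin d)) (z : S × A × S) :
    mdp.tdLinear γ (θ - θ') z = mdp.tdLinear γ θ z - mdp.tdLinear γ θ' z := by
  simp only [tdLinear, inner_sub_right, ← sub_smul]
  congr 1
  ring

theorem tdField_sub_tdField (θ θ' : EuclideanSpace ℝ (Fin d)) (z : S × A × S) :
    mdp.tdField γ θ z - mdp.tdField γ θ' z = mdp.tdLinear γ (θ - θ') z := by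
  rw [tdLinear_sub, tdField, tdField]
  abel

theorem norm_tdLinear_le (hγ : 0 ≤ γ) (hφ : ∀ s, ‖mdp.feature s‖ ≤ 1)
    (θ : EuclideanSpace ℝ (Fin d)) (z : S × A × S) : ‖mdp.tdLinear γ θ z‖ ≤ CB γ * ‖θ‖ := by
  have h : ∀ s, |inner ℝ (mdp.feature s) θ| ≤ ‖θ‖ := fun s =>
    (abs_real_inner_le_norm _ _).trans (mul_le_of_le_one_left (norm_nonneg _) (hφ s))
  rw [tdLinear, norm_smul, CB]
  refine (mul_le_of_le_one_right (norm_nonneg _) (hφ _)).trans ?_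
  refine (norm_sub_le _ _).trans ?_
  rw [norm_mul, Real.norm_of_nonneg hγ, Real.norm_eq_abs, Real.norm_eq_abs]
  nlinarith [h z.1, h z.2.2]

theorem meanReward_mem (hM : 0 < M) {Rmax : ℝ} (hr : ∀ m s a s', 0 ≤ mdp.reward m s a s')
    (hR : ∀ m s a s', mdp.reward m s a s' ≤ Rmax) (z : S × A × S) :
    mdp.meanReward z ∈ Set.Icc 0 Rmax := by
  have hM' : (0 : ℝ) < M := by exact_mod_cast hM
  refine ⟨mul_nonneg (by positivity) (Finset.sum_nonneg fun m _ => hr _ _ _ _), ?_⟩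
  rw [meanReward, one_div_mul_eq_div, div_le_iff₀ hM']
  calc ∑ m, mdp.reward m z.1 z.2.1 z.2.2 ≤ ∑ _m : Fin M, Rmax :=
        Finset.sum_le_sum fun m _ => hR _ _ _ _
    _ = Rmax * M := by simp [mul_comm]

theorem norm_tdField_le (hM : 0 < M) {Rmax : ℝ} (hr : ∀ m s a s', 0 ≤ mdp.reward m s a s')
    (hR : ∀ m s a s', mdp.reward m s a s' ≤ Rmax) (hγ : 0 ≤ γ) (hφ : ∀ s, ‖mdp.feature s‖ ≤ 1)
    (θ : EuclideanSpace ℝ (Fin d)) (z : S × A × S) :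
    ‖mdp.tdField γ θ z‖ ≤ CB γ * ‖θ‖ + Rmax := by
  obtain ⟨h0, h1⟩ := meanReward_mem hM hr hR z
  refine (norm_add_le _ _).trans ?_
  rw [add_comm, norm_smul, Real.norm_of_nonneg h0]
  exact add_le_add (norm_tdLinear_le hγ hφ θ z)
    ((mul_le_of_le_one_right h0 (hφ _)).trans h1)

theorem sum_mix {E : Type*} [AddCommGroup E] [Module ℝ E] (hW : W ∈ doublyStochastic ℝ (Fin M))
    (θ : Fin M → E) : ∑ m, ∑ m', W m m' • θ m' = ∑ m, θ m := by
  rw [Finset.sum_comm]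
  simp only [← Finset.sum_smul, (mem_doublyStochastic_iff_sum.1 hW).2.2, one_smul]

theorem meanCritic_zero (hM : 0 < M) : mdp.meanCritic γ W β Nc Tc θinit s a 0 = θinit := by
  have hM' : (M : ℝ) ≠ 0 := by exact_mod_cast hM.ne'
  simp [meanCritic, critic, ← Nat.cast_smul_eq_nsmul ℝ, smul_smul, hM']

theorem meanCritic_succ_of_le (hW : W ∈ doublyStochastic ℝ (Fin M)) {t : ℕ} (ht : Tc ≤ t) :
    mdp.meanCritic γ W β Nc Tc θinit s a (t + 1) = mdp.meanCritic γ W β Nc Tc θinit s a t := by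
  simp only [meanCritic, critic_succ_of_le ht, sum_mix hW]

theorem meanCritic_add (hW : W ∈ doublyStochastic ℝ (Fin M)) (k : ℕ) :
    mdp.meanCritic γ W β Nc Tc θinit s a (Tc + k) = mdp.meanCritic γ W β Nc Tc θinit s a Tc := by
  induction k with
  | zero => rfl
  | succ k ih => rw [← add_assoc, meanCritic_succ_of_le hW (Nat.le_add_right _ _), ih]

/-- Columns of `W` sum to one, so mixing drops out of the average; linearity of `tdLinear` in θ then
moves the average inside the TD direction. -/
theorem meanCritic_succ_of_lt (hW : W ∈ doublyStochastic ℝ (Fin M)) {t : ℕ} (ht : t < Tc) :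
    mdp.meanCritic γ W β Nc Tc θinit s a (t + 1) = mdp.meanCritic γ W β Nc Tc θinit s a t +
      (β / (Nc : ℝ)) • ∑ i ∈ Finset.Ico (t * Nc) ((t + 1) * Nc),
        mdp.tdField γ (mdp.meanCritic γ W β Nc Tc θinit s a t) (s i, a i, s (i + 1)) := by
  have h : ∀ z : S × A × S, mdp.tdField γ (mdp.meanCritic γ W β Nc Tc θinit s a t) z =
      (1 / (M : ℝ)) • ∑ m, (mdp.reward m z.1 z.2.1 z.2.2 • mdp.feature z.1 +
        mdp.tdLinear γ (mdp.critic γ W β Nc Tc θinit s a t m) z) := by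
    intro z
    rw [tdField, meanCritic, tdLinear_sum_smul, meanReward, Finset.sum_add_distrib, smul_add,
      mul_smul, Finset.sum_smul]
  simp only [h]
  simp only [meanCritic, critic_succ_of_lt ht, Finset.sum_add_distrib, sum_mix hW, smul_add,
    ← Finset.smul_sum]
  rw [smul_comm (β / (Nc : ℝ)) (1 / (M : ℝ)), smul_comm (β / (Nc : ℝ)) (1 / (M : ℝ)),
    Finset.sum_comm (s := Finset.univ), Finset.sum_comm (s := Finset.univ)]

theorem sum_critic_sub_mean (hM : 0 < M) (t : ℕ) :
    ∑ m, (mdp.critic γ W β Nc Tc θinit s a t m - mdp.meanCritic γ W β Nc Tc θinit s a t) = 0 := by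
  have hM' : (M : ℝ) ≠ 0 := by exact_mod_cast hM.ne'
  simp [meanCritic, Finset.sum_sub_distrib, ← Nat.cast_smul_eq_nsmul ℝ, smul_smul, hM']

theorem mix_sub {E : Type*} [AddCommGroup E] [Module ℝ E] (hW : W ∈ doublyStochastic ℝ (Fin M))
    (θ : Fin M → E) (v : E) (m : Fin M) :
    ∑ m', W m m' • θ m' - v = ∑ m', W m m' • (θ m' - v) := by
  simp only [smul_sub, Finset.sum_sub_distrib, ← Finset.sum_smul,
    (mem_doublyStochastic_iff_sum.1 hW).2.1, one_smul]

variable (mdp γ W β Nc Tc θinit s a) in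
/-- The Frobenius norm of the deviation of the critics from their average. -/
def consensusError (t : ℕ) : ℝ :=
  ‖WithLp.toLp 2 fun m =>
    mdp.critic γ W β Nc Tc θinit s a t m - mdp.meanCritic γ W β Nc Tc θinit s a t‖

theorem norm_mix_le (hM : 0 < M) (hW : W ∈ doublyStochastic ℝ (Fin M)) (hσ : sigmaW W < 1)
    (t : ℕ) :
    ‖WithLp.toLp 2 fun m => ∑ m', W m m' • (mdp.critic γ W β Nc Tc θinit s a t m' -
      mdp.meanCritic γ W β Nc Tc θinit s a t)‖ ≤
      sigmaW W * mdp.consensusError γ β W Nc Tc θinit s a t := by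
  refine le_of_sq_le_sq ?_ (mul_nonneg (LinearMap.singularValues_nonneg _ _) (norm_nonneg _))
  rw [mul_pow, consensusError, PiLp.norm_sq_eq_of_L2, PiLp.norm_sq_eq_of_L2]
  exact sum_norm_sq_mix_le hW hσ _ (sum_critic_sub_mean hM t)

theorem consensusError_add (hM : 0 < M) (hW : W ∈ doublyStochastic ℝ (Fin M))
    (hσ : sigmaW W < 1) (k : ℕ) :
    mdp.consensusError γ β W Nc Tc θinit s a (Tc + k) ≤
      sigmaW W ^ k * mdp.consensusError γ β W Nc Tc θinit s a Tc := by
  have hσ0 : 0 ≤ sigmaW W := LinearMap.singularValues_nonneg _ _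
  induction k with
  | zero => simp
  | succ k ih =>
    have h : mdp.consensusError γ β W Nc Tc θinit s a (Tc + (k + 1)) ≤
        sigmaW W * mdp.consensusError γ β W Nc Tc θinit s a (Tc + k) := by
      refine Eq.trans_le ?_ (norm_mix_le hM hW hσ (Tc + k))
      simp only [← mix_sub hW, ← add_assoc, consensusError,
        meanCritic_succ_of_le hW (Nat.le_add_right Tc k),
        critic_succ_of_le (Nat.le_add_right Tc k)]
    calc _ ≤ _ := h
      _ ≤ sigmaW W * (sigmaW W ^ k * mdp.consensusError γ β W Nc Tc θinit s a Tc) := by gcongr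
      _ = _ := by ring

/-- The new deviation has three parts: the mixed old deviation (factor σ_W), the linear TD map
applied to the old deviation (factor βC_B), and the gap between own and averaged reward, at most
R_max for each agent, hence √M R_max in Frobenius norm. -/
theorem consensusError_succ_le (hM : 0 < M) {Rmax : ℝ}
    (hr : ∀ m s a s', 0 ≤ mdp.reward m s a s') (hR : ∀ m s a s', mdp.reward m s a s' ≤ Rmax)
    (hγ : 0 ≤ γ) (hφ : ∀ s, ‖mdp.feature s‖ ≤ 1) (hβ : 0 ≤ β) (hR0 : 0 ≤ Rmax)
    (hW : W ∈ doublyStochastic ℝ (Fin M)) (hσ : sigmaW W < 1) {t : ℕ} (ht : t < Tc) :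
    mdp.consensusError γ β W Nc Tc θinit s a (t + 1) ≤
      (sigmaW W + β * CB γ) * mdp.consensusError γ β W Nc Tc θinit s a t + √M * (β * Rmax) := by
  set δ : Fin M → EuclideanSpace ℝ (Fin d) := fun m =>
    mdp.critic γ W β Nc Tc θinit s a t m - mdp.meanCritic γ W β Nc Tc θinit s a t with hδ
  have hCB : 0 ≤ CB γ := by unfold CB; linarith
  set I := Finset.Ico (t * Nc) ((t + 1) * Nc)
  set f : Fin M → EuclideanSpace ℝ (Fin d) := fun m =>
    (β / (Nc : ℝ)) • ∑ i ∈ I, mdp.tdLinear γ (δ m) (s i, a i, s (i + 1))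
  set g : Fin M → EuclideanSpace ℝ (Fin d) := fun m =>
    (β / (Nc : ℝ)) • ∑ i ∈ I, (mdp.reward m (s i) (a i) (s (i + 1)) -
      mdp.meanReward (s i, a i, s (i + 1))) • mdp.feature (s i)
  have hsplit : mdp.consensusError γ β W Nc Tc θinit s a (t + 1) =
      ‖(WithLp.toLp 2 fun m => ∑ m', W m m' • δ m') + WithLp.toLp 2 f + WithLp.toLp 2 g‖ := by
    rw [consensusError, ← WithLp.toLp_add, ← WithLp.toLp_add]
    congr 2
    funext m
    simp only [Pi.add_apply, f, g, hδ]
    rw [← mix_sub hW]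
    simp only [meanCritic_succ_of_lt hW ht,
      critic_succ_of_lt ht, tdLinear_sub, tdField, sub_smul, Finset.sum_add_distrib,
      Finset.sum_sub_distrib, smul_add, smul_sub]
    simp only [I]
    abel
  have hf : ‖WithLp.toLp 2 f‖ ≤ β * CB γ * ‖WithLp.toLp 2 δ‖ := by
    refine norm_toLp_le_mul (by positivity) fun m => ?_
    rw [mul_assoc]
    exact norm_smul_sum_Ico_le hβ (by positivity) Nc t _ fun i => norm_tdLinear_le hγ hφ _ _
  have hg : ‖WithLp.toLp 2 g‖ ≤ √M * (β * Rmax) := by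
    refine norm_toLp_le_sqrt_mul (by positivity) fun m => ?_
    refine norm_smul_sum_Ico_le hβ hR0 Nc t _ fun i => ?_
    rw [norm_smul]
    refine (mul_le_of_le_one_right (norm_nonneg _) (hφ _)).trans ?_
    obtain ⟨h0, h1⟩ := meanReward_mem hM hr hR (s i, a i, s (i + 1))
    rw [Real.norm_eq_abs, abs_le]
    have h2 := hr m (s i) (a i) (s (i + 1))
    have h3 := hR m (s i) (a i) (s (i + 1))
    constructor <;> linarith
  rw [hsplit]
  have hmix := norm_mix_le (mdp := mdp) (γ := γ) (β := β) (Nc := Nc) (Tc := Tc) (θinit := θinit)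
    (s := s) (a := a) hM hW hσ t
  refine norm_add₃_le.trans ?_
  have : mdp.consensusError γ β W Nc Tc θinit s a t = ‖WithLp.toLp 2 δ‖ := rfl
  rw [this] at hmix ⊢
  linarith

/-- The deviation starts at zero because the initial value is common. The bound is the fixed point
of the recursion of `consensusError_succ_le` with its factor enlarged to (1 + σ_W)/2. -/
theorem consensusError_le (hM : 0 < M) {Rmax : ℝ}
    (hr : ∀ m s a s', 0 ≤ mdp.reward m s a s') (hR : ∀ m s a s', mdp.reward m s a s' ≤ Rmax)
    (hγ : 0 ≤ γ) (hφ : ∀ s, ‖mdp.feature s‖ ≤ 1) (hβ : 0 ≤ β) (hR0 : 0 ≤ Rmax)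
    (hW : W ∈ doublyStochastic ℝ (Fin M)) (hσ : sigmaW W < 1)
    (hβσ : β * CB γ ≤ (1 - sigmaW W) / 2) {t : ℕ} (ht : t ≤ Tc) :
    mdp.consensusError γ β W Nc Tc θinit s a t ≤ β * (2 * √M * Rmax / (1 - sigmaW W)) := by
  have h1 : 0 < 1 - sigmaW W := by linarith
  induction t with
  | zero =>
    have : mdp.consensusError γ β W Nc Tc θinit s a 0 = 0 := by
      rw [consensusError, norm_eq_zero, meanCritic_zero hM]
      simp only [critic, sub_self]
      rfl
    rw [this]
    positivity
  | succ t ih =>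
    have h0 : 0 ≤ mdp.consensusError γ β W Nc Tc θinit s a t := norm_nonneg _
    calc _ ≤ _ := consensusError_succ_le hM hr hR hγ hφ hβ hR0 hW hσ ht
      _ ≤ (sigmaW W + (1 - sigmaW W) / 2) * mdp.consensusError γ β W Nc Tc θinit s a t
          + √M * (β * Rmax) := by gcongr
      _ ≤ (sigmaW W + (1 - sigmaW W) / 2) * (β * (2 * √M * Rmax / (1 - sigmaW W)))
          + √M * (β * Rmax) := by
        have : 0 ≤ sigmaW W := LinearMap.singularValues_nonneg _ _
        gcongr
        exact ih (Nat.le_of_succ_le ht)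
      _ = _ := by field_simp; ring

/-- The consensus error at the end of the algorithm. -/
theorem sum_norm_sq_critic_sub_meanCritic_le (hM : 0 < M) {Rmax : ℝ}
    (hr : ∀ m s a s', 0 ≤ mdp.reward m s a s') (hR : ∀ m s a s', mdp.reward m s a s' ≤ Rmax)
    (hγ : 0 ≤ γ) (hφ : ∀ s, ‖mdp.feature s‖ ≤ 1) (hβ : 0 ≤ β) (hR0 : 0 ≤ Rmax)
    (hW : W ∈ doublyStochastic ℝ (Fin M)) (hσ : sigmaW W < 1)
    (hβσ : β * CB γ ≤ (1 - sigmaW W) / 2) (k : ℕ) :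
    2 * ∑ m, ‖mdp.critic γ W β Nc Tc θinit s a (Tc + k) m -
      mdp.meanCritic γ W β Nc Tc θinit s a Tc‖ ^ 2 ≤
      sigmaW W ^ (2 * k) * β ^ 2 * c2 M (sigmaW W) Rmax := by
  have h1 : 0 < 1 - sigmaW W := by linarith
  have hσ0 : 0 ≤ sigmaW W := LinearMap.singularValues_nonneg _ _
  have h2 : mdp.consensusError γ β W Nc Tc θinit s a (Tc + k) ≤
      sigmaW W ^ k * (β * (2 * M * Rmax / (1 - sigmaW W))) := by
    refine (consensusError_add hM hW hσ k).trans ?_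
    gcongr
    refine (consensusError_le hM hr hR hγ hφ hβ hR0 hW hσ hβσ le_rfl).trans ?_
    gcongr
    -- The factor √M is relaxed to the M that appears in `c2`.
    rw [Real.sqrt_le_left (by positivity)]
    have : (1 : ℝ) ≤ M := by exact_mod_cast hM
    nlinarith
  have h3 := pow_le_pow_left₀ (norm_nonneg _) h2 2
  rw [PiLp.norm_sq_eq_of_L2] at h3
  simp only [meanCritic_add hW] at h3
  rw [c2]
  calc _ ≤ 2 * (sigmaW W ^ k * (β * (2 * M * Rmax / (1 - sigmaW W)))) ^ 2 := by gcongr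
    _ = _ := by ring

end MultiAgentMDP

/-! ### Total variation distance and differences of expectations. -/

section TotalVariation

variable {X : Type*} [MeasurableSpace X] {p q : Measure X} [IsProbabilityMeasure p]
  [IsProbabilityMeasure q]

theorem abs_measureReal_sub_le_one (E : Set X) : |p.real E - q.real E| ≤ 1 := by
  have h1 : p.real E ≤ 1 := measureReal_le_one
  have h2 : q.real E ≤ 1 := measureReal_le_one
  have h3 : 0 ≤ p.real E := measureReal_nonneg
  have h4 : 0 ≤ q.real E := measureReal_nonneg
  rw [abs_le]
  constructor <;> linarith

theorem abs_measureReal_sub_le_dTV {E : Set X} (hE : MeasurableSet E) :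
    |p.real E - q.real E| ≤ dTV p q := by
  have hb : BddAbove (Set.range fun E : {E : Set X // MeasurableSet E} =>
      |p.real E - q.real E|) := ⟨1, by rintro _ ⟨E, rfl⟩; exact abs_measureReal_sub_le_one _⟩
  exact le_ciSup hb ⟨E, hE⟩

theorem dTV_le_one : dTV p q ≤ 1 :=
  haveI : Nonempty {E : Set X // MeasurableSet E} := ⟨⟨∅, .empty⟩⟩
  ciSup_le fun _ => abs_measureReal_sub_le_one _

/-- A function with values in an interval of length `2 C` has expectations under two probability
measures which differ by at most `2 C` times their total variation distance. -/
theorem abs_integral_sub_le_dTV {f : X → ℝ} (hf : Measurable f) {c C : ℝ}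
    (h : ∀ x, |f x - c| ≤ C) : |∫ x, f x ∂p - ∫ x, f x ∂q| ≤ 2 * C * dTV p q := by
  have hC : 0 ≤ C := by
    obtain ⟨x⟩ : Nonempty X := nonempty_of_isProbabilityMeasure p
    exact (abs_nonneg _).trans (h x)
  -- After the shift the values lie in [0, 2C]; the layer-cake formula writes the expectation as an
  -- integral of tail probabilities over an interval of length 2C, and each tail differs by at most
  -- the total variation distance.
  set g : X → ℝ := fun x => f x - c + C with hg
  have hgm : Measurable g := by fun_prop
  have hg0 : ∀ x, 0 ≤ g x := fun x => by have := (abs_le.1 (h x)).1; simp only [hg]; linarith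
  have hg1 : ∀ x, g x ≤ 2 * C := fun x => by have := (abs_le.1 (h x)).2; simp only [hg]; linarith
  have hgi : ∀ r : Measure X, IsProbabilityMeasure r → Integrable g r := fun r _ =>
    Integrable.of_bound hgm.aestronglyMeasurable (2 * C)
      (.of_forall fun x => by rw [Real.norm_of_nonneg (hg0 x)]; exact hg1 x)
  have hlayer : ∀ r : Measure X, IsProbabilityMeasure r →
      ∫ x, f x ∂r = (∫ t in Set.Ioc 0 (2 * C), r.real {x | t ≤ g x}) + c - C := fun r hr => by
    rw [← (hgi r hr).integral_eq_integral_Ioc_meas_le (.of_forall hg0) (.of_forall hg1)]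
    have : ∀ x, f x = g x + (c - C) := fun x => by simp only [hg]; ring
    simp_rw [this]
    rw [integral_add (hgi r hr) (integrable_const _)]
    simp
    ring
  have hint : ∀ r : Measure X, IsProbabilityMeasure r →
      IntegrableOn (fun t => r.real {x | t ≤ g x}) (Set.Ioc 0 (2 * C)) := fun r _ => by
    refine Integrable.of_bound (C := 1) (Measurable.aestronglyMeasurable ?_)
      (.of_forall fun t => ?_)
    · refine Antitone.measurable fun s t hst => ?_
      exact measureReal_mono fun x hx => le_trans hst hx
    · rw [Real.norm_of_nonneg measureReal_nonneg]
      exact measureReal_le_one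
  have heq : ∫ x, f x ∂p - ∫ x, f x ∂q =
      ∫ t in Set.Ioc 0 (2 * C), (p.real {x | t ≤ g x} - q.real {x | t ≤ g x}) := by
    rw [hlayer p inferInstance, hlayer q inferInstance,
      integral_sub (hint p inferInstance) (hint q inferInstance)]
    ring
  rw [heq, ← Real.norm_eq_abs]
  refine (norm_setIntegral_le_of_norm_le_const (C := dTV p q) measure_Ioc_lt_top
    fun t _ => ?_).trans_eq ?_
  · exact abs_measureReal_sub_le_dTV (measurableSet_le measurable_const hgm)
  · rw [Real.volume_real_Ioc_of_le (by positivity)]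
    ring

end TotalVariation

theorem integrable_integral_compProd {X Y E : Type*} [MeasurableSpace X] [MeasurableSpace Y]
    [NormedAddCommGroup E] [NormedSpace ℝ E] {ν : Measure X} [SFinite ν] {κ : Kernel X Y}
    [IsSFiniteKernel κ] {f : X × Y → E} (hf : Integrable f (ν ⊗ₘ κ)) :
    Integrable (fun x => ∫ y, f (x, y) ∂κ x) ν := by
  rw [Measure.compProd] at hf
  simpa using hf.integral_compProd

/-! ### Joint laws along the sample path and the effect of mixing. -/

namespace MultiAgentMDP

variable {M d : ℕ} {S A Ω : Type*} [MeasurableSpace S] [MeasurableSpace A] [MeasurableSpace Ω]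
  (mdp : MultiAgentMDP M d S A Ω)

instance : IsMarkovKernel mdp.step := by unfold step; infer_instance

instance (ω : Ω) : IsMarkovKernel (mdp.stateKernel ω) := by unfold stateKernel; infer_instance

/-- The law of the state after `n` steps, as a kernel in the policy parameter and the state. -/
def stateIter : ℕ → Kernel (Ω × S) S
  | 0 => Kernel.deterministic Prod.snd measurable_snd
  | n + 1 => Kernel.snd (stateIter n ⊗ₖ
      (Kernel.snd mdp.step).comap (fun z : (Ω × S) × S => (z.1.1, z.2)) (by fun_prop))

instance : ∀ n, IsMarkovKernel (mdp.stateIter n)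
  | 0 => by unfold stateIter; infer_instance
  | n + 1 => by
    have := instIsMarkovKernelProdStateIter n
    unfold stateIter; infer_instance

theorem stateIter_succ_apply (n : ℕ) (x : Ω × S) {E : Set S} (hE : MeasurableSet E) :
    mdp.stateIter (n + 1) x E =
      ∫⁻ y, mdp.step (x.1, y) (Set.univ ×ˢ E) ∂mdp.stateIter n x := by
  rw [stateIter, Kernel.snd_apply' _ _ hE, Kernel.compProd_apply (measurable_snd hE)]
  refine lintegral_congr fun y => ?_
  change Kernel.snd mdp.step (x.1, y) E = _
  rw [Kernel.snd_apply' _ _ hE]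
  congr 1
  ext z
  simp

/-- The mixing assumption concerns powers of the kernel for a fixed ω, whereas a random ω calls for
joint measurability in (ω, s); this identifies the two descriptions. -/
theorem stateIter_apply (n : ℕ) (ω : Ω) (s : S) :
    mdp.stateIter n (ω, s) = (mdp.stateKernel ω ^ n) s := by
  induction n with
  | zero =>
    rw [stateIter, Kernel.deterministic_apply, pow_zero]
    exact (Kernel.id_apply s).symm
  | succ n ih =>
    ext E hE
    rw [stateIter_succ_apply _ _ _ hE, Kernel.pow_succ_apply_eq_lintegral _ _ _ hE, ih]
    refine lintegral_congr fun y => ?_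
    rw [stateKernel, Kernel.snd_apply' _ _ hE, Kernel.comap_apply]
    congr 1
    ext z
    simp

/-- The sample path of a Markov decision process under a finite measure: given the past, the action
and the next state have the law prescribed by `step`. -/
structure IsPath {Ω₀ : Type*} {m₀ : MeasurableSpace Ω₀} (Q : Measure Ω₀)
    (𝓕 : Filtration ℕ m₀) (ω : Ω₀ → Ω) (s : ℕ → Ω₀ → S) (a : ℕ → Ω₀ → A) : Prop where
  measurable_param : Measurable[𝓕 0] ω
  measurable_state : ∀ i, Measurable[𝓕 i] (s i)
  measurable_action : ∀ i, Measurable[𝓕 (i + 1)] (a i)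
  law : ∀ (i : ℕ) (E : Set (A × S)) (F : Set Ω₀), MeasurableSet E → MeasurableSet[𝓕 i] F →
    Q (F ∩ {x | (a i x, s (i + 1) x) ∈ E}) = ∫⁻ x in F, mdp.step (ω x, s i x) E ∂Q

variable {mdp} {Ω₀ : Type*} {m₀ : MeasurableSpace Ω₀} {𝓕 : Filtration ℕ m₀} {ω : Ω₀ → Ω}
  {s : ℕ → Ω₀ → S} {a : ℕ → Ω₀ → A}

/-- An event known at time 0 belongs to every `𝓕 i`, so intersecting the test events with it leaves
the transition law untouched. Integral estimates for the restricted measure thus become conditional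
estimates. -/
theorem IsMarkovianSample.isPath_restrict {Pr : Measure Ω₀} [IsFiniteMeasure Pr]
    (h : mdp.IsMarkovianSample Pr 𝓕 ω s a) {F₀ : Set Ω₀} (hF₀ : MeasurableSet[𝓕 0] F₀) :
    mdp.IsPath (Pr.restrict F₀) 𝓕 ω s a where
  measurable_param := h.measurable_param
  measurable_state := h.measurable_state
  measurable_action := h.measurable_action
  law i E F hE hF := by
    have hF₀' : MeasurableSet[𝓕 i] F₀ := 𝓕.mono (Nat.zero_le i) _ hF₀
    have hG : MeasurableSet[𝓕 i] (F ∩ F₀) := MeasurableSet.inter hF hF₀'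
    have hω := h.measurable_param.mono (𝓕.le 0) le_rfl
    have hs := fun i => (h.measurable_state i).mono (𝓕.le i) le_rfl
    have ha := fun i => (h.measurable_action i).mono (𝓕.le (i + 1)) le_rfl
    have hEm : MeasurableSet {x | (a i x, s (i + 1) x) ∈ E} :=
      ((ha i).prodMk (hs (i + 1))) hE
    have hst : Measurable fun x => mdp.step (ω x, s i x) E :=
      (mdp.step.measurable_coe hE).comp (hω.prodMk (hs i))
    have h1 : ∫ x in F ∩ F₀, ({x | (a i x, s (i + 1) x) ∈ E}).indicator (fun _ => (1 : ℝ)) x ∂Pr =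
        ∫ x in F ∩ F₀, (mdp.step (ω x, s i x)).real E ∂Pr := by
      rw [← setIntegral_condExp (𝓕.le i) ((integrable_const _).indicator hEm) hG]
      exact setIntegral_congr_ae (𝓕.le i _ hG) ((h.condLaw i E hE).mono fun x hx _ => hx)
    rw [Measure.restrict_apply ((𝓕.le i _ hF).inter hEm), Measure.restrict_restrict (𝓕.le i _ hF),
      Set.inter_right_comm, ← ENNReal.toReal_eq_toReal_iff' (measure_ne_top _ _)]
    · rw [setIntegral_indicator hEm, setIntegral_const, smul_eq_mul, mul_one] at h1
      rw [← measureReal_def, h1]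
      exact integral_toReal hst.aemeasurable (.of_forall fun x => measure_lt_top _ _)
    · refine ((lintegral_mono fun x => prob_le_one).trans_lt ?_).ne
      simp [measure_lt_top]

namespace IsPath

variable {Q : Measure Ω₀} {𝓧 : Type*} [MeasurableSpace 𝓧]

theorem measurable_param' (h : mdp.IsPath Q 𝓕 ω s a) : Measurable ω :=
  h.measurable_param.mono (𝓕.le 0) le_rfl

theorem measurable_state' (h : mdp.IsPath Q 𝓕 ω s a) (i : ℕ) : Measurable (s i) :=
  (h.measurable_state i).mono (𝓕.le i) le_rfl

theorem measurable_action' (h : mdp.IsPath Q 𝓕 ω s a) (i : ℕ) : Measurable (a i) :=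
  (h.measurable_action i).mono (𝓕.le (i + 1)) le_rfl

/-- `X` is an arbitrary record of what is known at time `i`, from which `p` reads off (ω, s i). The
Markov property then disintegrates the joint law of the record and the next transition. -/
theorem map_step [IsFiniteMeasure Q] (h : mdp.IsPath Q 𝓕 ω s a) {i : ℕ} {X : Ω₀ → 𝓧}
    (hX : Measurable[𝓕 i] X) {p : 𝓧 → Ω × S} (hp : Measurable p)
    (hpX : ∀ x, p (X x) = (ω x, s i x)) :
    Q.map (fun x => (X x, (a i x, s (i + 1) x))) = (Q.map X) ⊗ₘ (mdp.step.comap p hp) := by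
  have hXm : Measurable X := hX.mono (𝓕.le i) le_rfl
  refine Measure.ext_prod fun {U E} hU hE => ?_
  rw [Measure.map_apply (hXm.prodMk ((h.measurable_action' i).prodMk (h.measurable_state' _)))
    (hU.prod hE), Measure.compProd_apply_prod hU hE,
    setLIntegral_map hU (Kernel.measurable_coe _ hE) hXm]
  simp only [Kernel.comap_apply, hpX]
  exact h.law i E _ hE (hX hU)

/-- Chapman–Kolmogorov along the path, with the record `X` at time `k` carried along, so that later
integrands may depend on it. -/
theorem map_state [IsFiniteMeasure Q] (h : mdp.IsPath Q 𝓕 ω s a) {k : ℕ} {X : Ω₀ → 𝓧}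
    (hX : Measurable[𝓕 k] X) {p : 𝓧 → Ω × S} (hp : Measurable p)
    (hpX : ∀ x, p (X x) = (ω x, s k x)) (n : ℕ) :
    Q.map (fun x => (X x, s (k + n) x)) = (Q.map X) ⊗ₘ ((mdp.stateIter n).comap p hp) := by
  have hXm : Measurable X := hX.mono (𝓕.le k) le_rfl
  induction n with
  | zero =>
    refine Measure.ext_prod fun {U E} hU hE => ?_
    rw [Measure.map_apply (hXm.prodMk (h.measurable_state' _)) (hU.prod hE),
      Measure.compProd_apply_prod hU hE, setLIntegral_map hU (Kernel.measurable_coe _ hE) hXm]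
    simp only [Kernel.comap_apply, hpX, stateIter, Kernel.deterministic_apply' _ _ hE]
    rw [← lintegral_indicator (hXm hU)]
    have : ∀ x, (X ⁻¹' U).indicator (fun x => E.indicator (fun _ => (1 : ENNReal)) (s k x)) x =
        (X ⁻¹' U ∩ s k ⁻¹' E).indicator (fun _ => 1) x := fun x => by
      by_cases h1 : x ∈ X ⁻¹' U <;> by_cases h2 : x ∈ s k ⁻¹' E <;> simp_all
    rw [lintegral_congr this]
    rw [lintegral_indicator ((hXm hU).inter (h.measurable_state' k hE))]
    simp [Set.mk_preimage_prod]
  | succ n ih =>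
    have hX' : Measurable[𝓕 (k + n)] fun x => (X x, s (k + n) x) :=
      (hX.mono (𝓕.mono (Nat.le_add_right k n)) le_rfl).prodMk (h.measurable_state _)
    have hst := h.map_step hX' (p := fun z : 𝓧 × S => ((p z.1).1, z.2)) (by fun_prop)
      (fun x => by simp [hpX])
    rw [ih] at hst
    refine Measure.ext_prod fun {U E} hU hE => ?_
    rw [Measure.map_apply (hXm.prodMk (h.measurable_state' _)) (hU.prod hE),
      Measure.compProd_apply_prod hU hE]
    -- Rectangles that are free in the state at time `k + n` and in the action marginalize both.
    have h1 := congrArg (fun ν => ν ((U ×ˢ Set.univ) ×ˢ (Set.univ ×ˢ E))) hst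
    rw [Measure.map_apply ((hX'.mono (𝓕.le _) le_rfl).prodMk
        ((h.measurable_action' _).prodMk (h.measurable_state' _)))
        ((hU.prod .univ).prod (.prod .univ hE)),
      Measure.compProd_apply_prod (hU.prod .univ) (.prod .univ hE),
      Measure.setLIntegral_compProd (Kernel.measurable_coe _ (.prod .univ hE)) hU .univ] at h1
    have h2 : (fun x => ((X x, s (k + n) x), (a (k + n) x, s (k + n + 1) x))) ⁻¹'
        ((U ×ˢ Set.univ) ×ˢ (Set.univ ×ˢ E)) =
        (fun x => (X x, s (k + (n + 1)) x)) ⁻¹' (U ×ˢ E) := by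
      ext x; simp [← add_assoc]
    rw [← h2, h1]
    refine lintegral_congr fun x => ?_
    simp only [Kernel.comap_apply, Measure.restrict_univ, stateIter_succ_apply _ _ _ hE]

/-- Along a geometrically mixing path, a function of the sample at time `k + n` which is centred
under the stationary law has expectation at most `2 min(1, κ ρⁿ)` times that of its range, even if
it depends on what is known at time `k`. -/
theorem integral_le_of_mixing [IsFiniteMeasure Q] (h : mdp.IsPath Q 𝓕 ω s a)
    {μ : Ω → Measure S} {κ ρ Rmax lamPhi : ℝ} (hμ : mdp.Assumptions μ κ ρ Rmax lamPhi)
    {k : ℕ} {X : Ω₀ → 𝓧} (hX : Measurable[𝓕 k] X) {p : 𝓧 → Ω × S} (hp : Measurable p)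
    (hpX : ∀ x, p (X x) = (ω x, s k x)) {G : 𝓧 × S × A × S → ℝ} (hG : Measurable G)
    {c C : 𝓧 → ℝ} (hC : Measurable C) (hGC : ∀ x z, |G (x, z) - c x| ≤ C x)
    (hCi : Integrable (fun x => C (X x)) Q) {b : ℝ} (hb : ∀ x z, |G (X x, z)| ≤ b)
    (hG0 : ∀ x, ∫ z, G (x, z) ∂mdp.sampleLaw (μ (p x).1) (p x).1 = 0) (n : ℕ) :
    ∫ x, G (X x, s (k + n) x, a (k + n) x, s (k + n + 1) x) ∂Q ≤
      2 * min 1 (κ * ρ ^ n) * ∫ x, C (X x) ∂Q := by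
  have hXm : Measurable X := hX.mono (𝓕.le k) le_rfl
  have hs := h.measurable_state'
  have ha := h.measurable_action'
  set G' : (𝓧 × S) × (A × S) → ℝ := fun z => G (z.1.1, z.1.2, z.2) with hG'
  have hG'm : Measurable G' := by fun_prop
  have hX' : Measurable[𝓕 (k + n)] fun x => (X x, s (k + n) x) :=
    (hX.mono (𝓕.mono (Nat.le_add_right k n)) le_rfl).prodMk (h.measurable_state _)
  have hstep := h.map_step hX' (p := fun z : 𝓧 × S => ((p z.1).1, z.2)) (by fun_prop)
    (fun x => by simp [hpX])
  have hstate := h.map_state hX hp hpX n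
  have hXY : Measurable fun x => ((X x, s (k + n) x), (a (k + n) x, s (k + n + 1) x)) := by
    fun_prop
  have hint : Integrable G' (Q.map fun x => ((X x, s (k + n) x), (a (k + n) x, s (k + n + 1) x))) :=
    (integrable_map_measure hG'm.aestronglyMeasurable hXY.aemeasurable).2
      (Integrable.of_bound (hG'm.comp hXY).aestronglyMeasurable b (.of_forall fun x => hb _ _))
  have h1 : ∫ x, G (X x, s (k + n) x, a (k + n) x, s (k + n + 1) x) ∂Q =
      ∫ z, G' z ∂(Q.map fun x => ((X x, s (k + n) x), (a (k + n) x, s (k + n + 1) x))) :=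
    (integral_map hXY.aemeasurable hG'm.aestronglyMeasurable).symm
  rw [hstep] at hint h1
  rw [h1, Measure.integral_compProd hint]
  have hint2 := integrable_integral_compProd hint
  rw [hstate] at hint2 ⊢
  rw [Measure.integral_compProd hint2]
  have hint3 := integrable_integral_compProd hint2
  rw [← integral_const_mul, ← integral_map (f := fun x => 2 * min 1 (κ * ρ ^ n) * C x)
    hXm.aemeasurable (by fun_prop)]
  refine integral_mono hint3 ?_ fun x => ?_
  · exact ((integrable_map_measure hC.aestronglyMeasurable hXm.aemeasurable).2 hCi).const_mul _
  simp only [Kernel.comap_apply]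
  -- Averaging over the action and the next state leaves a function of the state at time `k + n`
  -- alone. It keeps the range of `G (x, ·)`, and its stationary mean is zero by `hG0`, so its
  -- expectation is a difference of expectations controlled by total variation.
  set g : S → ℝ := fun s => ∫ y, G' ((x, s), y) ∂mdp.step ((p x).1, s) with hg
  have hgm : Measurable g := by
    have : StronglyMeasurable fun s => ∫ y, G' ((x, s), y) ∂
        (mdp.step.comap (fun s : S => ((p x).1, s)) (by fun_prop)) s :=
      StronglyMeasurable.integral_kernel_prod_right'
        (f := fun z : S × (A × S) => G' ((x, z.1), z.2))
        (Measurable.stronglyMeasurable (by fun_prop))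
    exact this.measurable
  have hGx : Measurable fun z => G (x, z) := hG.comp measurable_prodMk_left
  have hGb : ∀ z, ‖G (x, z)‖ ≤ C x + |c x| := fun z => by
    have := abs_sub_abs_le_abs_sub (G (x, z)) (c x)
    rw [Real.norm_eq_abs]
    linarith [hGC x z]
  have hgc : ∀ s, |g s - c x| ≤ C x := fun s => by
    have : g s - c x = ∫ y, (G' ((x, s), y) - c x) ∂mdp.step ((p x).1, s) := by
      have hi : Integrable (fun y => G' ((x, s), y)) (mdp.step ((p x).1, s)) :=
        Integrable.of_bound (hGx.comp measurable_prodMk_left).aestronglyMeasurable _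
          (.of_forall fun y => hGb (s, y))
      rw [integral_sub hi (integrable_const _)]
      simp [hg]
    rw [this, ← Real.norm_eq_abs]
    refine (norm_integral_le_of_norm_le_const (C := C x)
      (.of_forall fun y => hGC x (s, y))).trans ?_
    simp
  have := hμ.isProbabilityMeasure (p x).1
  have hg0 : ∫ s, g s ∂μ (p x).1 = 0 := by
    rw [← hG0 x, sampleLaw, Measure.integral_compProd]
    · rfl
    · exact Integrable.of_bound hGx.aestronglyMeasurable _ (.of_forall hGb)
  have h3 := abs_integral_sub_le_dTV (p := mdp.stateIter n (p x)) (q := μ (p x).1) hgm hgc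
  have hCx : 0 ≤ C x := by
    obtain ⟨y⟩ : Nonempty S := nonempty_of_isProbabilityMeasure (μ (p x).1)
    exact (abs_nonneg _).trans (hgc y)
  have h4 : dTV (mdp.stateIter n (p x)) (μ (p x).1) ≤ min 1 (κ * ρ ^ n) :=
    le_min dTV_le_one (by
      rw [← Prod.mk.eta (p := p x), stateIter_apply]
      exact hμ.mixing _ n _)
  rw [hg0, sub_zero] at h3
  calc _ ≤ _ := le_abs_self _
    _ ≤ _ := h3
    _ ≤ 2 * C x * min 1 (κ * ρ ^ n) := by gcongr
    _ = _ := by ring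

end IsPath

end MultiAgentMDP

/-! ### The stationary TD field: monotonicity, its root, and measurability in the policy parameter.
-/

/-- The quadratic form of a symmetric matrix is bounded below by a lower bound of its
eigenvalues. -/
theorem mul_norm_sq_le_inner_toEuclideanLin {d : ℕ} {A : Matrix (Fin d) (Fin d) ℝ}
    (hA : A.IsHermitian) {c : ℝ}
    (hc : ∀ x, Module.End.HasEigenvalue (Matrix.toLin' A) x → c ≤ x)
    (v : EuclideanSpace ℝ (Fin d)) :
    c * ‖v‖ ^ 2 ≤ inner ℝ v (Matrix.toEuclideanLin A v) := by
  set T := Matrix.toEuclideanLin A with hT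
  have hn : Module.finrank ℝ (EuclideanSpace ℝ (Fin d)) = d := by simp
  have hsym : T.IsSymmetric := Matrix.isSymmetric_toEuclideanLin_iff.2 hA
  set u := hsym.eigenvectorBasis hn
  have hAu : ∀ i, T (u i) = hsym.eigenvalues hn i • u i := fun i =>
    hsym.apply_eigenvectorBasis hn i
  have hev : ∀ i, c ≤ hsym.eigenvalues hn i := fun i => by
    refine hc _ (Module.End.hasEigenvalue_of_hasEigenvector (x := (u i).ofLp) ⟨?_, ?_⟩)
    · rw [Module.End.mem_eigenspace_iff]
      exact congrArg WithLp.ofLp (hAu i)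
    · intro h
      have h1 : u i = 0 := by ext k; exact congrFun h k
      have h2 := u.orthonormal.1 i
      rw [h1, norm_zero] at h2
      exact zero_ne_one h2
  rw [← real_inner_self_eq_norm_sq, ← u.sum_inner_mul_inner v v, ← u.sum_inner_mul_inner v (T v),
    Finset.mul_sum]
  refine Finset.sum_le_sum fun i _ => ?_
  rw [← hsym (u i) v, hAu, real_inner_smul_left, real_inner_comm v (u i)]
  nlinarith [mul_le_mul_of_nonneg_right (hev i) (mul_self_nonneg (inner ℝ v (u i)))]

theorem lamB_pos {γ lamPhi : ℝ} (hγ1 : γ < 1) (hlam : 0 < lamPhi) : 0 < lamB γ lamPhi := by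
  unfold lamB
  have : 0 < 1 - γ := by linarith
  positivity

theorem measurable_det {X : Type*} [MeasurableSpace X] {n : ℕ}
    {A : X → Matrix (Fin n) (Fin n) ℝ} (hA : ∀ i j, Measurable fun x => A x i j) :
    Measurable fun x => (A x).det := by
  simp only [Matrix.det_apply]
  fun_prop

theorem integral_euclidean_apply {X : Type*} [MeasurableSpace X] {ν : Measure X} {d : ℕ}
    {f : X → EuclideanSpace ℝ (Fin d)} (hf : Integrable f ν) (i : Fin d) :
    (∫ x, f x ∂ν) i = ∫ x, f x i ∂ν :=
  ((EuclideanSpace.proj (𝕜 := ℝ) i).integral_comp_comm hf).symm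

namespace MultiAgentMDP

variable {M d : ℕ} {S A Ω : Type*} [MeasurableSpace S] [MeasurableSpace A] [MeasurableSpace Ω]
  {mdp : MultiAgentMDP M d S A Ω}

attribute [fun_prop] measurable_feature

@[fun_prop]
theorem measurable_meanReward : Measurable mdp.meanReward := by
  unfold meanReward
  exact (Finset.measurable_sum _ fun m _ => mdp.measurable_reward m).const_mul _

theorem measurable_tdLinear (γ : ℝ) :
    Measurable fun x : EuclideanSpace ℝ (Fin d) × S × A × S => mdp.tdLinear γ x.1 x.2 := by
  have := mdp.measurable_feature
  unfold tdLinear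
  fun_prop

theorem measurable_tdField (γ : ℝ) :
    Measurable fun x : EuclideanSpace ℝ (Fin d) × S × A × S => mdp.tdField γ x.1 x.2 := by
  have := mdp.measurable_feature
  have := mdp.measurable_tdLinear γ
  unfold tdField
  fun_prop

variable (mdp) in
/-- The expected temporal-difference direction under the stationary law. -/
def meanField (γ : ℝ) (μ : Ω → Measure S) (ω : Ω) (θ : EuclideanSpace ℝ (Fin d)) :
    EuclideanSpace ℝ (Fin d) :=
  ∫ z, mdp.tdField γ θ z ∂mdp.sampleLaw (μ ω) ω

namespace Assumptions

variable {μ : Ω → Measure S} {κ ρ Rmax lamPhi γ : ℝ}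

theorem isProbabilityMeasure_sampleLaw (h : mdp.Assumptions μ κ ρ Rmax lamPhi) (ω : Ω) :
    IsProbabilityMeasure (mdp.sampleLaw (μ ω) ω) := by
  have := h.isProbabilityMeasure ω
  unfold sampleLaw
  infer_instance

theorem map_fst_sampleLaw (h : mdp.Assumptions μ κ ρ Rmax lamPhi) (ω : Ω) :
    (mdp.sampleLaw (μ ω) ω).map Prod.fst = μ ω := by
  have := h.isProbabilityMeasure ω
  exact Measure.fst_compProd _ _

theorem map_next_sampleLaw (h : mdp.Assumptions μ κ ρ Rmax lamPhi) (ω : Ω) :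
    (mdp.sampleLaw (μ ω) ω).map (fun z => z.2.2) = μ ω := by
  have := h.isProbabilityMeasure ω
  conv_rhs => rw [← h.stationary ω]
  ext E hE
  rw [Measure.map_apply (by fun_prop) hE, Measure.bind_apply hE (Kernel.aemeasurable _),
    sampleLaw, Measure.compProd_apply (hE.preimage (by fun_prop))]
  refine lintegral_congr fun s => ?_
  rw [stateKernel, Kernel.snd_apply' _ _ hE]
  rfl

theorem norm_tdField_le (h : mdp.Assumptions μ κ ρ Rmax lamPhi) (hM : 0 < M) (hγ : 0 ≤ γ)
    (θ : EuclideanSpace ℝ (Fin d)) (z : S × A × S) :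
    ‖mdp.tdField γ θ z‖ ≤ CB γ * ‖θ‖ + Rmax :=
  MultiAgentMDP.norm_tdField_le hM h.reward_nonneg h.reward_le hγ h.feature_norm_le θ z

theorem integrable_tdField (h : mdp.Assumptions μ κ ρ Rmax lamPhi) (hM : 0 < M) (hγ : 0 ≤ γ)
    (ω : Ω) (θ : EuclideanSpace ℝ (Fin d)) :
    Integrable (mdp.tdField γ θ) (mdp.sampleLaw (μ ω) ω) := by
  have := h.isProbabilityMeasure_sampleLaw ω
  exact Integrable.of_bound ((measurable_tdField γ).comp
    measurable_prodMk_left).aestronglyMeasurable _ (.of_forall (h.norm_tdField_le hM hγ θ))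

theorem integrable_tdLinear (h : mdp.Assumptions μ κ ρ Rmax lamPhi) (hγ : 0 ≤ γ)
    (ω : Ω) (θ : EuclideanSpace ℝ (Fin d)) :
    Integrable (mdp.tdLinear γ θ) (mdp.sampleLaw (μ ω) ω) := by
  have := h.isProbabilityMeasure_sampleLaw ω
  exact Integrable.of_bound ((measurable_tdLinear γ).comp
    measurable_prodMk_left).aestronglyMeasurable _
    (.of_forall (norm_tdLinear_le hγ h.feature_norm_le θ))

theorem norm_meanField_le (h : mdp.Assumptions μ κ ρ Rmax lamPhi) (hM : 0 < M) (hγ : 0 ≤ γ)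
    (ω : Ω) (θ : EuclideanSpace ℝ (Fin d)) :
    ‖mdp.meanField γ μ ω θ‖ ≤ CB γ * ‖θ‖ + Rmax := by
  have := h.isProbabilityMeasure_sampleLaw ω
  refine (norm_integral_le_of_norm_le_const (.of_forall (h.norm_tdField_le hM hγ θ))).trans ?_
  simp

theorem meanField_sub (h : mdp.Assumptions μ κ ρ Rmax lamPhi) (hM : 0 < M) (hγ : 0 ≤ γ)
    (ω : Ω) (θ θ' : EuclideanSpace ℝ (Fin d)) :
    mdp.meanField γ μ ω θ - mdp.meanField γ μ ω θ' =
      ∫ z, mdp.tdLinear γ (θ - θ') z ∂mdp.sampleLaw (μ ω) ω := by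
  rw [meanField, meanField, ← integral_sub (h.integrable_tdField hM hγ ω θ)
    (h.integrable_tdField hM hγ ω θ')]
  simp only [tdField_sub_tdField]

theorem norm_meanField_sub_le (h : mdp.Assumptions μ κ ρ Rmax lamPhi) (hM : 0 < M) (hγ : 0 ≤ γ)
    (ω : Ω) (θ θ' : EuclideanSpace ℝ (Fin d)) :
    ‖mdp.meanField γ μ ω θ - mdp.meanField γ μ ω θ'‖ ≤ CB γ * ‖θ - θ'‖ := by
  have := h.isProbabilityMeasure_sampleLaw ω
  rw [h.meanField_sub hM hγ]
  refine (norm_integral_le_of_norm_le_const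
    (.of_forall (norm_tdLinear_le hγ h.feature_norm_le _))).trans ?_
  simp

theorem integrable_feature_mul (h : mdp.Assumptions μ κ ρ Rmax lamPhi) (ω : Ω) (i j : Fin d) :
    Integrable (fun s => mdp.feature s i * mdp.feature s j) (μ ω) := by
  have := h.isProbabilityMeasure ω
  have hm : ∀ i, Measurable fun s => mdp.feature s i := fun i =>
    (EuclideanSpace.proj (𝕜 := ℝ) i).measurable.comp mdp.measurable_feature
  refine Integrable.of_bound ((hm i).mul (hm j)).aestronglyMeasurable 1 (.of_forall fun s => ?_)
  have hb : ∀ i, ‖mdp.feature s i‖ ≤ 1 := fun i =>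
    (PiLp.norm_apply_le _ i).trans (h.feature_norm_le s)
  rw [norm_mul]
  exact mul_le_one₀ (hb i) (norm_nonneg _) (hb j)

theorem integral_inner_feature_sq (h : mdp.Assumptions μ κ ρ Rmax lamPhi) (ω : Ω)
    (v : EuclideanSpace ℝ (Fin d)) :
    ∫ s, inner ℝ (mdp.feature s) v ^ 2 ∂μ ω =
      inner ℝ v (Matrix.toEuclideanLin (mdp.featureCov (μ ω)) v) := by
  have h1 : ∀ s, inner ℝ (mdp.feature s) v ^ 2 =
      ∑ i, ∑ j, v i * v j * (mdp.feature s i * mdp.feature s j) := fun s => by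
    rw [sq, PiLp.inner_apply, Finset.sum_mul_sum]
    refine Finset.sum_congr rfl fun i _ => Finset.sum_congr rfl fun j _ => ?_
    simp only [RCLike.inner_apply, conj_trivial]
    ring
  simp_rw [h1]
  rw [integral_finsetSum _ fun i _ => integrable_finsetSum _ fun j _ =>
    (h.integrable_feature_mul ω i j).const_mul _, PiLp.inner_apply]
  refine Finset.sum_congr rfl fun i _ => ?_
  rw [integral_finsetSum _ fun j _ => (h.integrable_feature_mul ω i j).const_mul _]
  simp only [integral_const_mul, Matrix.toLpLin_apply, Matrix.mulVec, dotProduct, featureCov,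
    Matrix.of_apply, RCLike.inner_apply, conj_trivial, Finset.sum_mul]
  exact Finset.sum_congr rfl fun j _ => by ring

theorem mul_norm_sq_le_integral_inner_feature (h : mdp.Assumptions μ κ ρ Rmax lamPhi) (ω : Ω)
    (v : EuclideanSpace ℝ (Fin d)) :
    lamPhi * ‖v‖ ^ 2 ≤ ∫ s, inner ℝ (mdp.feature s) v ^ 2 ∂μ ω := by
  rw [h.integral_inner_feature_sq]
  refine mul_norm_sq_le_inner_toEuclideanLin ?_ (h.le_eigenvalue ω) v
  ext i j
  simp [featureCov, mul_comm]

/-- The stationary temporal-difference operator is negative definite. -/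
theorem inner_integral_tdLinear_le (h : mdp.Assumptions μ κ ρ Rmax lamPhi) (hγ : 0 ≤ γ)
    (hγ1 : γ < 1) (ω : Ω) (v : EuclideanSpace ℝ (Fin d)) :
    inner ℝ v (∫ z, mdp.tdLinear γ v z ∂mdp.sampleLaw (μ ω) ω) ≤
      -(lamB γ lamPhi / 2 * ‖v‖ ^ 2) := by
  have := h.isProbabilityMeasure_sampleLaw ω
  have := h.isProbabilityMeasure ω
  have hφ := mdp.measurable_feature
  have hm : Measurable fun s => inner ℝ (mdp.feature s) v ^ 2 := by fun_prop
  have hb : ∀ s, ‖inner ℝ (mdp.feature s) v ^ 2‖ ≤ ‖v‖ ^ 2 := fun s => by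
    rw [norm_pow]
    refine pow_le_pow_left₀ (norm_nonneg _) ?_ 2
    exact (norm_inner_le_norm _ _).trans
      (mul_le_of_le_one_left (norm_nonneg _) (h.feature_norm_le s))
  have h1 : ∫ z, inner ℝ (mdp.feature z.1) v ^ 2 ∂mdp.sampleLaw (μ ω) ω =
      ∫ s, inner ℝ (mdp.feature s) v ^ 2 ∂μ ω := by
    conv_rhs => rw [← h.map_fst_sampleLaw ω]
    exact (integral_map measurable_fst.aemeasurable hm.aestronglyMeasurable).symm
  -- Invariance of μ enters here: the next state has the same law as the current one.
  have h2 : ∫ z, inner ℝ (mdp.feature z.2.2) v ^ 2 ∂mdp.sampleLaw (μ ω) ω =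
      ∫ s, inner ℝ (mdp.feature s) v ^ 2 ∂μ ω := by
    conv_rhs => rw [← h.map_next_sampleLaw ω]
    exact (integral_map (φ := fun z : S × A × S => z.2.2)
      (by fun_prop) hm.aestronglyMeasurable).symm
  have hi1 : Integrable (fun z : S × A × S => inner ℝ (mdp.feature z.1) v ^ 2)
      (mdp.sampleLaw (μ ω) ω) :=
    Integrable.of_bound (hm.comp measurable_fst).aestronglyMeasurable _ (.of_forall fun z => hb _)
  have hi2 : Integrable (fun z : S × A × S => inner ℝ (mdp.feature z.2.2) v ^ 2)
      (mdp.sampleLaw (μ ω) ω) :=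
    Integrable.of_bound (hm.comp (g := fun s => inner ℝ (mdp.feature s) v ^ 2)
      (f := fun z : S × A × S => z.2.2) (by fun_prop)).aestronglyMeasurable _
      (.of_forall fun z => hb _)
  rw [← integral_inner (h.integrable_tdLinear hγ ω v)]
  calc ∫ z, inner ℝ v (mdp.tdLinear γ v z) ∂mdp.sampleLaw (μ ω) ω
      ≤ ∫ z, (γ / 2 * inner ℝ (mdp.feature z.2.2) v ^ 2 +
          (γ / 2 - 1) * inner ℝ (mdp.feature z.1) v ^ 2) ∂mdp.sampleLaw (μ ω) ω := by
        refine integral_mono ((h.integrable_tdLinear hγ ω v).const_inner v)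
          ((hi2.const_mul _).add (hi1.const_mul _)) fun z => ?_
        simp only [tdLinear, real_inner_smul_right, real_inner_comm (mdp.feature z.1) v]
        -- With x and x' the inner products of v with the current and next feature, this is 2γxx' ≤
        -- γ(x² + x'²).
        nlinarith [mul_nonneg hγ (sq_nonneg (inner ℝ (mdp.feature z.2.2) v -
          inner ℝ (mdp.feature z.1) v))]
    _ = -((1 - γ) * ∫ s, inner ℝ (mdp.feature s) v ^ 2 ∂μ ω) := by
        rw [integral_add (hi2.const_mul _) (hi1.const_mul _), integral_const_mul,
          integral_const_mul, h1, h2]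
        ring
    _ ≤ _ := by
        have := mul_le_mul_of_nonneg_left (h.mul_norm_sq_le_integral_inner_feature ω v)
          (by linarith : 0 ≤ 1 - γ)
        rw [lamB]
        linarith

theorem inner_meanField_sub_le (h : mdp.Assumptions μ κ ρ Rmax lamPhi) (hM : 0 < M) (hγ : 0 ≤ γ)
    (hγ1 : γ < 1) (ω : Ω) (θ θ' : EuclideanSpace ℝ (Fin d)) :
    inner ℝ (θ - θ') (mdp.meanField γ μ ω θ - mdp.meanField γ μ ω θ') ≤
      -(lamB γ lamPhi / 2 * ‖θ - θ'‖ ^ 2) := by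
  rw [h.meanField_sub hM hγ]
  exact h.inner_integral_tdLinear_le hγ hγ1 ω _

theorem toEuclideanLin_tdMatrix (h : mdp.Assumptions μ κ ρ Rmax lamPhi) (hγ : 0 ≤ γ)
    (ω : Ω) (v : EuclideanSpace ℝ (Fin d)) :
    Matrix.toEuclideanLin (mdp.tdMatrix γ (μ ω) ω) v =
      ∫ z, mdp.tdLinear γ v z ∂mdp.sampleLaw (μ ω) ω := by
  have := h.isProbabilityMeasure_sampleLaw ω
  have hm : ∀ i, Measurable fun s => mdp.feature s i := fun i =>
    (EuclideanSpace.proj (𝕜 := ℝ) i).measurable.comp mdp.measurable_feature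
  have hb : ∀ s i, ‖mdp.feature s i‖ ≤ 1 := fun s i =>
    (PiLp.norm_apply_le _ i).trans (h.feature_norm_le s)
  ext i
  rw [integral_euclidean_apply (h.integrable_tdLinear hγ ω v)]
  have hint : ∀ j, Integrable (fun z : S × A × S => mdp.feature z.1 i *
      (γ * mdp.feature z.2.2 j - mdp.feature z.1 j)) (mdp.sampleLaw (μ ω) ω) := fun j => by
    refine Integrable.of_bound (C := 1 * (γ * 1 + 1)) (Measurable.aestronglyMeasurable ?_)
      (.of_forall fun z => ?_)
    · have := hm i
      have := hm j
      fun_prop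
    · rw [norm_mul]
      refine mul_le_mul (hb _ _) ((norm_sub_le _ _).trans (add_le_add ?_ (hb _ _)))
        (norm_nonneg _) zero_le_one
      rw [norm_mul, Real.norm_of_nonneg hγ]
      exact mul_le_mul_of_nonneg_left (hb _ _) hγ
  have h1 : ∀ z : S × A × S, mdp.tdLinear γ v z i =
      ∑ j, mdp.feature z.1 i * (γ * mdp.feature z.2.2 j - mdp.feature z.1 j) * v j := fun z => by
    simp only [tdLinear, PiLp.smul_apply, smul_eq_mul, PiLp.inner_apply, RCLike.inner_apply,
      conj_trivial, Finset.mul_sum, ← Finset.sum_sub_distrib, Finset.sum_mul]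
    exact Finset.sum_congr rfl fun j _ => by ring
  simp_rw [h1]
  rw [integral_finsetSum _ fun j _ => (hint j).mul_const _]
  simp only [integral_mul_const, Matrix.toLpLin_apply, Matrix.mulVec, dotProduct, tdMatrix,
    Matrix.of_apply]

theorem integrable_reward_smul (h : mdp.Assumptions μ κ ρ Rmax lamPhi) (hM : 0 < M) (ω : Ω) :
    Integrable (fun z : S × A × S => mdp.meanReward z • mdp.feature z.1)
      (mdp.sampleLaw (μ ω) ω) := by
  refine (h.integrable_tdField hM (γ := 0) le_rfl ω 0).congr (.of_forall fun z => ?_)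
  simp [tdField, tdLinear]

theorem meanField_eq (h : mdp.Assumptions μ κ ρ Rmax lamPhi) (hM : 0 < M) (hγ : 0 ≤ γ)
    (ω : Ω) (θ : EuclideanSpace ℝ (Fin d)) :
    mdp.meanField γ μ ω θ = WithLp.toLp 2 (mdp.tdVector (μ ω) ω) +
      Matrix.toEuclideanLin (mdp.tdMatrix γ (μ ω) ω) θ := by
  rw [h.toEuclideanLin_tdMatrix hγ, meanField]
  have h1 : WithLp.toLp 2 (mdp.tdVector (μ ω) ω) =
      ∫ z, mdp.meanReward z • mdp.feature z.1 ∂mdp.sampleLaw (μ ω) ω := by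
    ext i
    rw [integral_euclidean_apply (h.integrable_reward_smul hM ω)]
    rfl
  rw [h1, ← integral_add (h.integrable_reward_smul hM ω) (h.integrable_tdLinear hγ ω θ)]
  rfl

/-- Negative definiteness makes `tdMatrix` injective, hence invertible, so the `⁻¹` in
`optimalCritic` is a genuine inverse. -/
theorem meanField_optimalCritic (h : mdp.Assumptions μ κ ρ Rmax lamPhi) (hM : 0 < M) (hγ : 0 ≤ γ)
    (hγ1 : γ < 1) (hlam : 0 < lamPhi) (ω : Ω) :
    mdp.meanField γ μ ω (mdp.optimalCritic γ (μ ω) ω) = 0 := by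
  have hinj : Function.Injective (mdp.tdMatrix γ (μ ω) ω).mulVec := by
    refine (injective_iff_map_eq_zero (Matrix.mulVecLin (mdp.tdMatrix γ (μ ω) ω))).2 fun v hv => ?_
    have h1 := h.inner_integral_tdLinear_le hγ hγ1 ω (WithLp.toLp 2 v)
    rw [← h.toEuclideanLin_tdMatrix hγ, Matrix.toLpLin_apply] at h1
    rw [Matrix.mulVecLin_apply] at hv
    rw [hv] at h1
    simp only [WithLp.toLp_zero, inner_zero_right] at h1
    have h2 : ‖WithLp.toLp 2 v‖ ^ 2 ≤ 0 := by
      have := lamB_pos (γ := γ) hγ1 hlam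
      nlinarith [sq_nonneg ‖WithLp.toLp 2 v‖]
    have h3 : WithLp.toLp 2 v = 0 := by
      rw [← norm_eq_zero]
      exact pow_eq_zero_iff two_ne_zero |>.1 (le_antisymm h2 (sq_nonneg _))
    exact congrArg WithLp.ofLp h3
  have hdet : IsUnit (mdp.tdMatrix γ (μ ω) ω).det :=
    (Matrix.isUnit_iff_isUnit_det _).1 (Matrix.mulVec_injective_iff_isUnit.1 hinj)
  rw [h.meanField_eq hM hγ, optimalCritic, Matrix.toLpLin_apply]
  simp only [Matrix.mulVec_neg, Matrix.mulVec_mulVec, Matrix.mul_nonsing_inv _ hdet,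
    Matrix.one_mulVec, WithLp.toLp_neg, add_neg_cancel]

/-- Monotonicity between θ* and 0 gives (λ_B/2)‖θ*‖² ≤ ⟨θ*, b⟩ ≤ R_max‖θ*‖. -/
theorem norm_optimalCritic_le (h : mdp.Assumptions μ κ ρ Rmax lamPhi) (hM : 0 < M) (hγ : 0 ≤ γ)
    (hγ1 : γ < 1) (hlam : 0 < lamPhi) (hR : 0 ≤ Rmax) (ω : Ω) :
    ‖mdp.optimalCritic γ (μ ω) ω‖ ≤ Rtheta γ lamPhi Rmax := by
  have hl := lamB_pos (γ := γ) hγ1 hlam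
  set θ := mdp.optimalCritic γ (μ ω) ω with hθ
  have h1 := h.inner_meanField_sub_le hM hγ hγ1 ω θ 0
  rw [h.meanField_optimalCritic hM hγ hγ1 hlam, sub_zero, zero_sub, inner_neg_right] at h1
  have h2 := h.norm_meanField_le hM hγ ω 0
  rw [norm_zero, mul_zero, zero_add] at h2
  have h3 := (real_inner_le_norm θ (mdp.meanField γ μ ω 0)).trans
    (mul_le_mul_of_nonneg_left h2 (norm_nonneg _))
  rw [Rtheta, le_div_iff₀ hl]
  rcases (norm_nonneg θ).eq_or_lt with h0 | h0
  · rw [← h0]; linarith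
  · refine le_of_mul_le_mul_left ?_ h0
    nlinarith

/-- The monotonicity constant λ_B/2 cannot exceed the Lipschitz constant C_B, as any nonzero vector
shows. -/
theorem lamB_le (h : mdp.Assumptions μ κ ρ Rmax lamPhi) (hM : 0 < M) (hγ : 0 ≤ γ)
    (hγ1 : γ < 1) (ω : Ω) {v : EuclideanSpace ℝ (Fin d)} (hv : v ≠ 0) :
    lamB γ lamPhi ≤ 2 * CB γ := by
  have h1 := h.inner_meanField_sub_le hM hγ hγ1 ω v 0
  have h2 := h.norm_meanField_sub_le hM hγ ω v 0
  rw [sub_zero] at h1 h2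
  have h3 := neg_le_of_abs_le (abs_real_inner_le_norm v
    (mdp.meanField γ μ ω v - mdp.meanField γ μ ω 0))
  have h4 := mul_le_mul_of_nonneg_left h2 (norm_nonneg v)
  have h5 : 0 < ‖v‖ ^ 2 := by positivity
  refine le_of_mul_le_mul_right ?_ h5
  nlinarith

/-- Started from one fixed state, the n-step laws are measurable in ω and converge to μ ω on every
event, so measurability of μ is a consequence of mixing. -/
theorem measurable_stationary (h : mdp.Assumptions μ κ ρ Rmax lamPhi) (hρ0 : 0 < ρ)
    (hρ1 : ρ < 1) : Measurable μ := by
  rcases isEmpty_or_nonempty Ω with hΩ | ⟨⟨ω₀⟩⟩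
  · exact measurable_of_empty _
  have := h.isProbabilityMeasure
  obtain ⟨s₀⟩ : Nonempty S := nonempty_of_isProbabilityMeasure (μ ω₀)
  refine Measure.measurable_of_measurable_coe _ fun E hE => ?_
  have hlim : Tendsto (fun (n : ℕ) ω => (mdp.stateIter n (ω, s₀)).real E) atTop
      (𝓝 fun ω => (μ ω).real E) := by
    refine tendsto_pi_nhds.2 fun ω => ?_
    rw [tendsto_iff_dist_tendsto_zero]
    refine squeeze_zero (fun _ => dist_nonneg) (fun n => ?_)
      (by simpa using (tendsto_pow_atTop_nhds_zero_of_lt_one hρ0.le hρ1).const_mul κ)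
    rw [Real.dist_eq]
    refine (abs_measureReal_sub_le_dTV hE).trans ?_
    rw [stateIter_apply]
    exact h.mixing ω n s₀
  have hmeas : Measurable fun ω => (μ ω).real E :=
    measurable_of_tendsto_metrizable (fun n => (((mdp.stateIter n).measurable_coe hE).comp
      measurable_prodMk_right).ennreal_toReal) hlim
  simpa [measureReal_def] using hmeas.ennreal_ofReal

/-- The stationary law of the samples depends measurably on the policy parameter. -/
theorem exists_kernel_sampleLaw (h : mdp.Assumptions μ κ ρ Rmax lamPhi) (hρ0 : 0 < ρ)
    (hρ1 : ρ < 1) :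
    ∃ η : Kernel Ω (S × A × S), IsMarkovKernel η ∧ ∀ ω, η ω = mdp.sampleLaw (μ ω) ω := by
  set ν : Kernel Ω S := ⟨μ, h.measurable_stationary hρ0 hρ1⟩
  have hν : IsMarkovKernel ν := ⟨h.isProbabilityMeasure⟩
  refine ⟨ν ⊗ₖ mdp.step, inferInstance, fun ω => ?_⟩
  rw [Kernel.compProd_apply_eq_compProd_sectR]
  rfl

theorem measurable_meanField (h : mdp.Assumptions μ κ ρ Rmax lamPhi) (hρ0 : 0 < ρ)
    (hρ1 : ρ < 1) (γ : ℝ) :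
    Measurable fun x : EuclideanSpace ℝ (Fin d) × Ω => mdp.meanField γ μ x.2 x.1 := by
  obtain ⟨η, hη, hηω⟩ := h.exists_kernel_sampleLaw hρ0 hρ1
  have : StronglyMeasurable fun x : EuclideanSpace ℝ (Fin d) × Ω =>
      ∫ z, mdp.tdField γ x.1 z ∂(η.comap Prod.snd measurable_snd) x :=
    StronglyMeasurable.integral_kernel_prod_right'
      (f := fun y : (EuclideanSpace ℝ (Fin d) × Ω) × S × A × S => mdp.tdField γ y.1.1 y.2)
      ((measurable_tdField γ).comp
        (f := fun y : (EuclideanSpace ℝ (Fin d) × Ω) × S × A × S => (y.1.1, y.2))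
        (by fun_prop)).stronglyMeasurable
  simp only [Kernel.comap_apply, hηω] at this
  exact this.measurable

theorem measurable_optimalCritic (h : mdp.Assumptions μ κ ρ Rmax lamPhi) (hρ0 : 0 < ρ)
    (hρ1 : ρ < 1) (γ : ℝ) : Measurable fun ω => mdp.optimalCritic γ (μ ω) ω := by
  obtain ⟨η, hη, hηω⟩ := h.exists_kernel_sampleLaw hρ0 hρ1
  have hm : ∀ i, Measurable fun s => mdp.feature s i := fun i =>
    (EuclideanSpace.proj (𝕜 := ℝ) i).measurable.comp mdp.measurable_feature
  have hint : ∀ f : S × A × S → ℝ, Measurable f →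
      Measurable fun ω => ∫ z, f z ∂mdp.sampleLaw (μ ω) ω := fun f hf => by
    simp only [← hηω]
    exact hf.stronglyMeasurable.integral_kernel.measurable
  have hmat : ∀ i j, Measurable fun ω => mdp.tdMatrix γ (μ ω) ω i j := fun i j =>
    hint _ (by have := hm i; have := hm j; fun_prop)
  have hvec : ∀ i, Measurable fun ω => mdp.tdVector (μ ω) ω i := fun i =>
    hint _ (measurable_meanReward.mul ((hm i).comp measurable_fst))
  have hinv : ∀ i j, Measurable fun ω => (mdp.tdMatrix γ (μ ω) ω)⁻¹ i j := fun i j => by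
    -- The inverse is the adjugate over the determinant, so measurability reduces to that of
    -- determinants of measurable entries.
    simp only [Matrix.inv_def, Ring.inverse_eq_inv', Matrix.smul_apply, Matrix.adjugate_apply,
      smul_eq_mul]
    refine (measurable_det hmat).inv.mul (measurable_det fun k l => ?_)
    simp only [Matrix.updateRow_apply]
    split_ifs
    · exact measurable_const
    · exact hmat k l
  unfold optimalCritic
  refine (WithLp.measurable_toLp 2 _).comp (measurable_pi_lambda _ fun i => ?_)
  simp only [Pi.neg_apply, Matrix.mulVec, dotProduct]
  exact (Finset.measurable_sum _ fun j _ => (hinv i j).mul (hvec j)).neg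

end Assumptions

end MultiAgentMDP

/-! ### Second moments of sums with geometrically decaying correlations. -/

/-- The factor `[1 + (κ - 1) ρ] / (1 - ρ)` by which mixing inflates the variance of a sample
average. -/
def mixFactor (κ ρ : ℝ) : ℝ := (1 + (κ - 1) * ρ) / (1 - ρ)

section Mixing

variable {κ ρ : ℝ}

theorem mixFactor_eq (hρ1 : ρ < 1) : mixFactor κ ρ = 1 + κ * ρ / (1 - ρ) := by
  have : 1 - ρ ≠ 0 := by linarith
  rw [mixFactor]
  field_simp
  ring

theorem one_le_mixFactor (hκ : 0 < κ) (hρ0 : 0 < ρ) (hρ1 : ρ < 1) : 1 ≤ mixFactor κ ρ := by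
  have : 0 < 1 - ρ := by linarith
  rw [mixFactor_eq hρ1]
  have : 0 ≤ κ * ρ / (1 - ρ) := by positivity
  linarith

/-- Bounding the term `n = 0` by 1 instead of κ yields 1 + κρ/(1 - ρ), which equals [1 + (κ -
1)ρ]/(1 - ρ). -/
theorem sum_min_le_mixFactor (hκ : 0 < κ) (hρ0 : 0 < ρ) (hρ1 : ρ < 1) (N : ℕ) :
    ∑ n ∈ Finset.range N, min 1 (κ * ρ ^ n) ≤ mixFactor κ ρ := by
  have h1 : 0 < 1 - ρ := by linarith
  cases N with
  | zero => simpa using zero_le_one.trans (one_le_mixFactor hκ hρ0 hρ1)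
  | succ N =>
    rw [Finset.sum_range_succ', mixFactor_eq hρ1, add_comm]
    refine add_le_add (min_le_left _ _) ?_
    calc ∑ n ∈ Finset.range N, min 1 (κ * ρ ^ (n + 1))
        ≤ ∑ n ∈ Finset.range N, κ * ρ * ρ ^ n :=
          Finset.sum_le_sum fun n _ => (min_le_right _ _).trans_eq (by ring)
      _ = κ * ρ * ∑ n ∈ Finset.range N, ρ ^ n := (Finset.mul_sum _ _ _).symm
      _ ≤ κ * ρ * (1 / (1 - ρ)) := by
          gcongr
          rw [le_div_iff₀ h1, geom_sum_mul_neg]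
          linarith [pow_nonneg hρ0.le N]
      _ = κ * ρ / (1 - ρ) := by ring

/-- The second moment of a sum of random vectors with geometrically decaying correlations grows
linearly. -/
theorem integral_norm_sq_sum_le {Ω₀ E : Type*} [MeasurableSpace Ω₀] {Q : Measure Ω₀}
    [NormedAddCommGroup E] [InnerProductSpace ℝ E] (hκ : 0 < κ) (hρ0 : 0 < ρ) (hρ1 : ρ < 1)
    {Y : ℕ → Ω₀ → E} (hY : ∀ i j, Integrable (fun x => inner ℝ (Y i x) (Y j x)) Q) {V : ℝ}
    (hV0 : 0 ≤ V) (hV : ∀ i, ∫ x, inner ℝ (Y i x) (Y i x) ∂Q ≤ 4 * V)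
    (hcov : ∀ i n, ∫ x, inner ℝ (Y i x) (Y (i + 1 + n) x) ∂Q ≤ 4 * min 1 (κ * ρ ^ n) * V)
    (N : ℕ) :
    ∫ x, ‖∑ i ∈ Finset.range N, Y i x‖ ^ 2 ∂Q ≤ 12 * mixFactor κ ρ * N * V := by
  have hsq : ∀ N x, ‖∑ i ∈ Finset.range N, Y i x‖ ^ 2 =
      ∑ i ∈ Finset.range N, ∑ j ∈ Finset.range N, inner ℝ (Y i x) (Y j x) := fun N x => by
    rw [← real_inner_self_eq_norm_sq, sum_inner]
    exact Finset.sum_congr rfl fun i _ => inner_sum _ _ _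
  have hint : ∀ N, Integrable (fun x => ‖∑ i ∈ Finset.range N, Y i x‖ ^ 2) Q := fun N => by
    simp only [hsq]
    exact integrable_finsetSum _ fun i _ => integrable_finsetSum _ fun j _ => hY i j
  have h1 := one_le_mixFactor hκ hρ0 hρ1
  induction N with
  | zero => simp
  | succ N ih =>
    have hstep : ∀ x, ‖∑ i ∈ Finset.range (N + 1), Y i x‖ ^ 2 =
        ‖∑ i ∈ Finset.range N, Y i x‖ ^ 2 + inner ℝ (Y N x) (Y N x) +
          2 * ∑ i ∈ Finset.range N, inner ℝ (Y i x) (Y N x) := fun x => by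
      rw [Finset.sum_range_succ, norm_add_sq_real, real_inner_self_eq_norm_sq, sum_inner]
      ring
    -- The pair (i, N) has lag `N - 1 - i`; reversing the sum gives the series of
    -- `sum_min_le_mixFactor`.
    have hcross : ∫ x, ∑ i ∈ Finset.range N, inner ℝ (Y i x) (Y N x) ∂Q ≤
        4 * mixFactor κ ρ * V := by
      rw [integral_finsetSum _ fun i _ => hY i N]
      calc ∑ i ∈ Finset.range N, ∫ x, inner ℝ (Y i x) (Y N x) ∂Q
          ≤ ∑ i ∈ Finset.range N, 4 * min 1 (κ * ρ ^ (N - 1 - i)) * V := by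
            refine Finset.sum_le_sum fun i hi => ?_
            have hi' := Finset.mem_range.1 hi
            have h := hcov i (N - 1 - i)
            rwa [show i + 1 + (N - 1 - i) = N by omega] at h
        _ = ∑ i ∈ Finset.range N, 4 * min 1 (κ * ρ ^ i) * V :=
            Finset.sum_range_reflect (fun i => 4 * min 1 (κ * ρ ^ i) * V) N
        _ = 4 * (∑ i ∈ Finset.range N, min 1 (κ * ρ ^ i)) * V := by
            rw [← Finset.sum_mul, ← Finset.mul_sum]
        _ ≤ 4 * mixFactor κ ρ * V := by
            gcongr
            exact sum_min_le_mixFactor hκ hρ0 hρ1 N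
    have hic : Integrable (fun x => ∑ i ∈ Finset.range N, inner ℝ (Y i x) (Y N x)) Q :=
      integrable_finsetSum _ fun i _ => hY i N
    have hi2 : Integrable (fun x => ‖∑ i ∈ Finset.range N, Y i x‖ ^ 2 +
        inner ℝ (Y N x) (Y N x)) Q := (hint N).add (hY N N)
    simp only [hstep]
    rw [integral_add hi2 (hic.const_mul 2), integral_add (hint N) (hY N N), integral_const_mul]
    push_cast
    -- The new term costs 4V on the diagonal and 2 · 4KV off it, where K is the mixing factor; K ≥ 1
    -- turns this into 12KV.
    nlinarith [hV N]

end Mixing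

namespace MultiAgentMDP

variable {M d : ℕ} {S A Ω : Type*} [MeasurableSpace S] [MeasurableSpace A] [MeasurableSpace Ω]
  {mdp : MultiAgentMDP M d S A Ω}

/-! ### Measurability and crude bounds for the critics. -/

section Regularity

variable {γ β : ℝ} {W : Matrix (Fin M) (Fin M) ℝ} {Nc Tc : ℕ} {θinit : EuclideanSpace ℝ (Fin d)}

/-- The index ranges record exactly which samples enter the first `t` iterations. Through
`measurable_meanCritic` this makes the iterate measurable for `𝓕 (t * Nc)`, that is, known before
batch `t` is drawn. -/
theorem measurable_critic {X : Type*} [MeasurableSpace X] {s : ℕ → X → S} {a : ℕ → X → A} (t : ℕ)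
    (hs : ∀ i ≤ t * Nc, Measurable (s i)) (ha : ∀ i < t * Nc, Measurable (a i)) (m : Fin M) :
    Measurable fun x =>
      mdp.critic γ W β Nc Tc θinit (fun i => s i x) (fun i => a i x) t m := by
  induction t generalizing m with
  | zero => exact measurable_const
  | succ t ih =>
    have hle : t * Nc ≤ (t + 1) * Nc := Nat.mul_le_mul_right _ (Nat.le_succ t)
    have ih' := ih (fun i hi => hs i (hi.trans hle)) (fun i hi => ha i (hi.trans_le hle))
    have hmix : Measurable fun x => ∑ m', W m m' •
        mdp.critic γ W β Nc Tc θinit (fun i => s i x) (fun i => a i x) t m' :=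
      Finset.measurable_sum _ fun m' _ => (ih' m').const_smul (W m m')
    by_cases ht : t < Tc
    · simp only [critic_succ_of_lt ht]
      refine hmix.add (Measurable.const_smul (Finset.measurable_sum _ fun i hi => ?_)
        (β / (Nc : ℝ)))
      obtain ⟨-, hi⟩ := Finset.mem_Ico.1 hi
      have h1 := hs i hi.le
      have h2 := hs (i + 1) hi
      have h3 := ha i hi
      refine Measurable.add ?_ ?_
      · exact ((mdp.measurable_reward m).comp (h1.prodMk (h3.prodMk h2))).smul
          (mdp.measurable_feature.comp h1)
      · exact (measurable_tdLinear (mdp := mdp) γ).comp (f := fun x =>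
          (mdp.critic γ W β Nc Tc θinit (fun i => s i x) (fun i => a i x) t m,
            s i x, a i x, s (i + 1) x)) ((ih' m).prodMk (h1.prodMk (h3.prodMk h2)))
    · simpa only [critic_succ_of_le (not_lt.1 ht)] using hmix

theorem measurable_meanCritic {X : Type*} [mX : MeasurableSpace X] {s : ℕ → X → S} {a : ℕ → X → A}
    (t : ℕ) (hs : ∀ i ≤ t * Nc, Measurable (s i)) (ha : ∀ i < t * Nc, Measurable (a i)) :
    Measurable fun x =>
      mdp.meanCritic γ W β Nc Tc θinit (fun i => s i x) (fun i => a i x) t := by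
  unfold meanCritic
  exact (Finset.measurable_sum _ fun m _ => measurable_critic t hs ha m).const_smul (1 / (M : ℝ))

/-- The bound may grow with `t`, but it is uniform over sample paths; it serves integrability only
and enters no constant of the rate. -/
theorem exists_norm_critic_le {Rmax : ℝ} (hr : ∀ m s a s', 0 ≤ mdp.reward m s a s')
    (hR : ∀ m s a s', mdp.reward m s a s' ≤ Rmax) (hR0 : 0 ≤ Rmax) (hγ : 0 ≤ γ)
    (hφ : ∀ s, ‖mdp.feature s‖ ≤ 1) (hβ : 0 ≤ β) (t : ℕ) :
    ∃ b, 0 ≤ b ∧ ∀ (s : ℕ → S) (a : ℕ → A) (m : Fin M),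
      ‖mdp.critic γ W β Nc Tc θinit s a t m‖ ≤ b := by
  have hCB : 0 ≤ CB γ := by unfold CB; linarith
  induction t with
  | zero => exact ⟨‖θinit‖, norm_nonneg _, fun s a m => le_rfl⟩
  | succ t ih =>
    obtain ⟨b, hb0, hb⟩ := ih
    have hmix : ∀ (s : ℕ → S) (a : ℕ → A) (m : Fin M),
        ‖∑ m', W m m' • mdp.critic γ W β Nc Tc θinit s a t m'‖ ≤ ∑ m, ∑ m', |W m m'| * b := by
      intro s a m
      refine (norm_sum_le_of_le _ fun m' _ => ?_).trans
        (Finset.single_le_sum (f := fun m => ∑ m', |W m m'| * b)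
          (fun m _ => Finset.sum_nonneg fun m' _ => by positivity) (Finset.mem_univ m))
      rw [norm_smul, Real.norm_eq_abs]
      exact mul_le_mul_of_nonneg_left (hb s a m') (abs_nonneg _)
    refine ⟨(∑ m, ∑ m', |W m m'| * b) + β * (Rmax + CB γ * b), by positivity, fun s a m => ?_⟩
    by_cases ht : t < Tc
    · rw [critic_succ_of_lt ht]
      refine (norm_add_le _ _).trans (add_le_add (hmix s a m) ?_)
      refine norm_smul_sum_Ico_le hβ (by positivity) Nc t _ fun i => ?_
      refine (norm_add_le _ _).trans (add_le_add ?_ ?_)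
      · rw [norm_smul, Real.norm_of_nonneg (hr _ _ _ _)]
        exact (mul_le_of_le_one_right (hr _ _ _ _) (hφ _)).trans (hR _ _ _ _)
      · exact (norm_tdLinear_le hγ hφ _ _).trans (mul_le_mul_of_nonneg_left (hb s a m) hCB)
    · rw [critic_succ_of_le (not_lt.1 ht)]
      exact (hmix s a m).trans (le_add_of_nonneg_right (by positivity))

theorem norm_meanCritic_le (hM : 0 < M) {s : ℕ → S} {a : ℕ → A} {t : ℕ} {b : ℝ}
    (hb : ∀ m, ‖mdp.critic γ W β Nc Tc θinit s a t m‖ ≤ b) :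
    ‖mdp.meanCritic γ W β Nc Tc θinit s a t‖ ≤ b := by
  have hM' : (0 : ℝ) < M := by exact_mod_cast hM
  rw [meanCritic, norm_smul, Real.norm_of_nonneg (by positivity), one_div_mul_eq_div,
    div_le_iff₀ hM']
  refine (norm_sum_le_of_le _ fun m _ => hb m).trans_eq ?_
  simp [mul_comm]

end Regularity

/-! ### Covariances and second moment of the noise in one mini-batch. -/

section Variance

variable {Ω₀ : Type*} {m₀ : MeasurableSpace Ω₀} {𝓕 : Filtration ℕ m₀} {ω : Ω₀ → Ω}
  {s : ℕ → Ω₀ → S} {a : ℕ → Ω₀ → A} {Q : Measure Ω₀} {μ : Ω → Measure S}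
  {κ ρ Rmax lamPhi γ : ℝ}

theorem Assumptions.norm_tdField_sub_meanField_le (hμ : mdp.Assumptions μ κ ρ Rmax lamPhi)
    (hM : 0 < M) (hγ : 0 ≤ γ) (ω : Ω) (θ : EuclideanSpace ℝ (Fin d)) (z : S × A × S) :
    ‖mdp.tdField γ θ z - mdp.meanField γ μ ω θ‖ ≤ 2 * (CB γ * ‖θ‖ + Rmax) := by
  refine (norm_sub_le _ _).trans ?_
  linarith [hμ.norm_tdField_le hM hγ θ z, hμ.norm_meanField_le hM hγ ω θ]

/-- The first transition ends in the state at time `k + 1`, so the record must include that state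
and the lag is counted from there. Given the record, the first noise is fixed and the second is
centred under the stationary law. -/
theorem IsPath.integral_inner_le [IsFiniteMeasure Q] (h : mdp.IsPath Q 𝓕 ω s a)
    (hμ : mdp.Assumptions μ κ ρ Rmax lamPhi) (hM : 0 < M) (hγ : 0 ≤ γ) (hR : 0 ≤ Rmax)
    (hρ0 : 0 < ρ) (hρ1 : ρ < 1) {k : ℕ} {θ : Ω₀ → EuclideanSpace ℝ (Fin d)}
    (hθ : Measurable[𝓕 k] θ) {b : ℝ} (hb : ∀ x, ‖θ x‖ ≤ b) (n : ℕ) :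
    ∫ x, inner ℝ
      (mdp.tdField γ (θ x) (s k x, a k x, s (k + 1) x) - mdp.meanField γ μ (ω x) (θ x))
      (mdp.tdField γ (θ x) (s (k + 1 + n) x, a (k + 1 + n) x, s (k + 1 + n + 1) x) -
        mdp.meanField γ μ (ω x) (θ x)) ∂Q ≤
      4 * min 1 (κ * ρ ^ n) * ∫ x, (CB γ * ‖θ x‖ + Rmax) ^ 2 ∂Q := by
  have hCB : 0 ≤ CB γ := by unfold CB; linarith
  have hθ' := hθ.mono (𝓕.le k) le_rfl
  have hF := mdp.measurable_tdField γ
  have hmF := hμ.measurable_meanField hρ0 hρ1 γ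
  set X : Ω₀ → Ω × EuclideanSpace ℝ (Fin d) × S × A × S := fun x =>
    (ω x, θ x, s k x, a k x, s (k + 1) x) with hXdef
  have hX : Measurable[𝓕 (k + 1)] X :=
    (h.measurable_param.mono (𝓕.mono (Nat.zero_le _)) le_rfl).prodMk
      ((hθ.mono (𝓕.mono (Nat.le_succ k)) le_rfl).prodMk
        (((h.measurable_state k).mono (𝓕.mono (Nat.le_succ k)) le_rfl).prodMk
          ((h.measurable_action k).prodMk (h.measurable_state (k + 1)))))
  set D : Ω × EuclideanSpace ℝ (Fin d) × S × A × S → EuclideanSpace ℝ (Fin d) := fun y =>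
    mdp.tdField γ y.2.1 y.2.2 - mdp.meanField γ μ y.1 y.2.1 with hD
  have hDm : Measurable D := (hF.comp measurable_snd).sub (hmF.comp
    (f := fun y : Ω × EuclideanSpace ℝ (Fin d) × S × A × S => (y.2.1, y.1)) (by fun_prop))
  have hDb : ∀ y, ‖D y‖ ≤ 2 * (CB γ * ‖y.2.1‖ + Rmax) := fun y =>
    hμ.norm_tdField_sub_meanField_le hM hγ _ _ _
  set L : EuclideanSpace ℝ (Fin d) → ℝ := fun θ => CB γ * ‖θ‖ + Rmax with hL
  have hLm : Measurable L := by fun_prop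
  have hLb : ∀ x, L (θ x) ≤ CB γ * b + Rmax := fun x => by simp only [hL]; gcongr; exact hb x
  have hL0 : ∀ θ, 0 ≤ L θ := fun θ => by positivity
  set G : (Ω × EuclideanSpace ℝ (Fin d) × S × A × S) × S × A × S → ℝ := fun y =>
    inner ℝ (D y.1) (D (y.1.1, y.1.2.1, y.2)) with hG
  have hGm : Measurable G := (hDm.comp measurable_fst).inner (hDm.comp
    (f := fun y : (Ω × EuclideanSpace ℝ (Fin d) × S × A × S) × S × A × S =>
      (y.1.1, y.1.2.1, y.2)) (by fun_prop))
  -- Removing the constant `c` leaves ⟨D, tdField⟩, of size at most 2L² instead of the 4L² of ⟨D,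
  -- D⟩; together with the 2 of total variation this gives the factor 4.
  have key := h.integral_le_of_mixing hμ hX (p := fun y => (y.1, y.2.2.2.2)) (by fun_prop)
    (fun x => rfl) hGm (c := fun y => -inner ℝ (D y) (mdp.meanField γ μ y.1 y.2.1))
    (C := fun y => 2 * L y.2.1 ^ 2) (by fun_prop) ?_ ?_
    (b := (2 * (CB γ * b + Rmax)) * (2 * (CB γ * b + Rmax))) ?_ ?_ n
  · refine key.trans_eq ?_
    simp only [hXdef, hL]
    rw [integral_const_mul]
    ring
  · intro y z
    have h1 : G (y, z) - -inner ℝ (D y) (mdp.meanField γ μ y.1 y.2.1) =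
        inner ℝ (D y) (mdp.tdField γ y.2.1 z) := by
      simp only [hG]
      rw [sub_neg_eq_add, ← inner_add_right]
      simp [hD]
    rw [h1]
    calc _ ≤ ‖D y‖ * ‖mdp.tdField γ y.2.1 z‖ := abs_real_inner_le_norm _ _
      _ ≤ (2 * L y.2.1) * L y.2.1 := by
        have := hL0 y.2.1
        exact mul_le_mul (hDb y) (hμ.norm_tdField_le hM hγ _ _) (norm_nonneg _) (by positivity)
      _ = 2 * L y.2.1 ^ 2 := by ring
  · refine Integrable.of_bound (C := 2 * (CB γ * b + Rmax) ^ 2)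
      (Measurable.aestronglyMeasurable ?_) (.of_forall fun x => ?_)
    · exact ((hLm.comp hθ').pow_const 2).const_mul 2
    · rw [Real.norm_of_nonneg (by positivity)]
      exact mul_le_mul_of_nonneg_left (pow_le_pow_left₀ (hL0 _) (hLb x) 2) zero_le_two
  · intro x z
    have h0 := hL0 (θ x)
    have hD2 : ∀ z', ‖D ((X x).1, (X x).2.1, z')‖ ≤ 2 * (CB γ * b + Rmax) := fun z' =>
      (hDb _).trans (mul_le_mul_of_nonneg_left (hLb x) zero_le_two)
    refine (abs_real_inner_le_norm _ _).trans ?_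
    exact mul_le_mul (hD2 _) (hD2 _) (norm_nonneg _)
      (mul_nonneg zero_le_two (h0.trans (hLb x)))
  · intro y
    have := hμ.isProbabilityMeasure_sampleLaw y.1
    have hi := hμ.integrable_tdField hM hγ y.1 y.2.1
    simp only [hG]
    have hDi : Integrable (fun z => D (y.1, y.2.1, z)) (mdp.sampleLaw (μ y.1) y.1) :=
      hi.sub (integrable_const (mdp.meanField γ μ y.1 y.2.1))
    rw [integral_inner hDi]
    have h0 : ∫ z, D (y.1, y.2.1, z) ∂mdp.sampleLaw (μ y.1) y.1 = 0 := by
      simp only [hD]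
      rw [integral_sub hi (integrable_const _)]
      simp [meanField]
    rw [h0, inner_zero_right]

/-- The mean squared deviation of a sum of consecutive temporal-difference directions from its
stationary expectation. -/
theorem IsPath.integral_norm_sq_batch_le [IsFiniteMeasure Q] (h : mdp.IsPath Q 𝓕 ω s a)
    (hμ : mdp.Assumptions μ κ ρ Rmax lamPhi) (hM : 0 < M) (hγ : 0 ≤ γ) (hR : 0 ≤ Rmax)
    (hκ : 0 < κ) (hρ0 : 0 < ρ) (hρ1 : ρ < 1) {k : ℕ} {θ : Ω₀ → EuclideanSpace ℝ (Fin d)}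
    (hθ : Measurable[𝓕 k] θ) {b : ℝ} (hb : ∀ x, ‖θ x‖ ≤ b) (N : ℕ) :
    ∫ x, ‖∑ i ∈ Finset.range N,
      (mdp.tdField γ (θ x) (s (k + i) x, a (k + i) x, s (k + i + 1) x) -
        mdp.meanField γ μ (ω x) (θ x))‖ ^ 2 ∂Q ≤
      12 * mixFactor κ ρ * N * ∫ x, (CB γ * ‖θ x‖ + Rmax) ^ 2 ∂Q := by
  have hCB : 0 ≤ CB γ := by unfold CB; linarith
  have hθ' := hθ.mono (𝓕.le k) le_rfl
  have hs := h.measurable_state'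
  have ha := h.measurable_action'
  have hω := h.measurable_param'
  set Y : ℕ → Ω₀ → EuclideanSpace ℝ (Fin d) := fun i x =>
    mdp.tdField γ (θ x) (s (k + i) x, a (k + i) x, s (k + i + 1) x) -
      mdp.meanField γ μ (ω x) (θ x) with hY
  have hYm : ∀ i, Measurable (Y i) := fun i =>
    ((mdp.measurable_tdField γ).comp (hθ'.prodMk ((hs _).prodMk ((ha _).prodMk (hs _))))).sub
      ((hμ.measurable_meanField hρ0 hρ1 γ).comp (hθ'.prodMk hω))
  have hYL : ∀ i x, ‖Y i x‖ ≤ 2 * (CB γ * ‖θ x‖ + Rmax) := fun i x =>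
    hμ.norm_tdField_sub_meanField_le hM hγ _ _ _
  have hYb : ∀ i x, ‖Y i x‖ ≤ 2 * (CB γ * b + Rmax) := fun i x =>
    (hYL i x).trans (by gcongr; exact hb x)
  have hint : ∀ i j, Integrable (fun x => inner ℝ (Y i x) (Y j x)) Q := fun i j =>
    Integrable.of_bound ((hYm i).inner (hYm j)).aestronglyMeasurable
      ((2 * (CB γ * b + Rmax)) * (2 * (CB γ * b + Rmax))) (.of_forall fun x =>
        (norm_inner_le_norm _ _).trans (mul_le_mul (hYb i x) (hYb j x) (norm_nonneg _)
          ((norm_nonneg _).trans (hYb i x))))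
  have hLi : Integrable (fun x => (CB γ * ‖θ x‖ + Rmax) ^ 2) Q := by
    refine Integrable.of_bound (C := (CB γ * b + Rmax) ^ 2) (Measurable.aestronglyMeasurable
      (by fun_prop)) (.of_forall fun x => ?_)
    rw [Real.norm_of_nonneg (by positivity)]
    gcongr
    exact hb x
  refine integral_norm_sq_sum_le hκ hρ0 hρ1 hint (integral_nonneg fun x => by positivity)
    (fun i => ?_) (fun i n => ?_) N
  · rw [← integral_const_mul]
    refine integral_mono (hint i i) (hLi.const_mul 4) fun x => ?_
    simp only [real_inner_self_eq_norm_sq]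
    calc ‖Y i x‖ ^ 2 ≤ (2 * (CB γ * ‖θ x‖ + Rmax)) ^ 2 :=
          pow_le_pow_left₀ (norm_nonneg _) (hYL i x) 2
      _ = _ := by ring
  · have := h.integral_inner_le hμ hM hγ hR hρ0 hρ1 (k := k + i)
      (hθ.mono (𝓕.mono (Nat.le_add_right k i)) le_rfl) hb n
    simpa only [hY, ← add_assoc] using this

end Variance

end MultiAgentMDP

/-! ### One-step contraction and the error recursion of the averaged critic. -/

section Constants

variable {γ κ ρ lamPhi Rmax : ℝ}

theorem c1_eq : c1 γ κ ρ lamPhi Rmax =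
    1920 * (CB γ ^ 2 * Rtheta γ lamPhi Rmax ^ 2 + Rmax ^ 2) * mixFactor κ ρ /
      lamB γ lamPhi ^ 2 := by
  rw [c1, mixFactor, div_mul_eq_div_div, mul_div_assoc]

theorem batchMin_eq (β : ℝ) : batchMin γ κ ρ lamPhi β =
    (2 / lamB γ lamPhi + 2 * β) * (192 * CB γ ^ 2 * mixFactor κ ρ / lamB γ lamPhi) := by
  rw [batchMin, mixFactor, div_mul_eq_div_div, mul_div_assoc]

end Constants

/-- The drift contributes -lβ to the coefficient of ‖e‖², Young's inequality for the noise returns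
lβ/4, and the second-order term 2β²C² ≤ lβ/4 returns the rest, leaving -lβ/2. The noise coefficient
is 4β/l + 2β². -/
theorem norm_sq_add_smul_le {E : Type*} [NormedAddCommGroup E] [InnerProductSpace ℝ E]
    {e g Δ : E} {l β C : ℝ} (hl : 0 < l) (hβ : 0 ≤ β) (hβC : 8 * C ^ 2 * β ≤ l)
    (hg : inner ℝ e g ≤ -(l / 2 * ‖e‖ ^ 2)) (hgC : ‖g‖ ≤ C * ‖e‖) :
    ‖e + β • (g + Δ)‖ ^ 2 ≤ (1 - l * β / 2) * ‖e‖ ^ 2 + 2 * β * (2 / l + β) * ‖Δ‖ ^ 2 := by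
  have h1 : ‖e + β • (g + Δ)‖ ^ 2 =
      ‖e‖ ^ 2 + 2 * β * inner ℝ e g + 2 * β * inner ℝ e Δ + β ^ 2 * ‖g + Δ‖ ^ 2 := by
    rw [norm_add_sq_real, norm_smul, mul_pow, real_inner_smul_right, inner_add_right,
      Real.norm_of_nonneg hβ]
    ring
  have h2 : ‖g + Δ‖ ^ 2 ≤ 2 * (C ^ 2 * ‖e‖ ^ 2) + 2 * ‖Δ‖ ^ 2 := by
    have h3 : ‖g + Δ‖ ^ 2 ≤ (‖g‖ + ‖Δ‖) ^ 2 := pow_le_pow_left₀ (norm_nonneg _) (norm_add_le _ _) 2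
    have h4 := pow_le_pow_left₀ (norm_nonneg _) hgC 2
    nlinarith [sq_nonneg (‖g‖ - ‖Δ‖)]
  have h5 : 2 * inner ℝ e Δ ≤ l / 4 * ‖e‖ ^ 2 + 4 / l * ‖Δ‖ ^ 2 := by
    have h6 : l / 4 * ‖e‖ ^ 2 + 4 / l * ‖Δ‖ ^ 2 - 2 * (‖e‖ * ‖Δ‖) =
        4 / l * (l / 4 * ‖e‖ - ‖Δ‖) ^ 2 := by
      field_simp
      ring
    have h7 : 0 ≤ 4 / l * (l / 4 * ‖e‖ - ‖Δ‖) ^ 2 := by positivity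
    linarith [real_inner_le_norm e Δ]
  have h8 : 8 * C ^ 2 * β * (β * ‖e‖ ^ 2) ≤ l * (β * ‖e‖ ^ 2) := by gcongr
  rw [h1]
  calc _ ≤ ‖e‖ ^ 2 + 2 * β * (-(l / 2 * ‖e‖ ^ 2)) +
        β * (l / 4 * ‖e‖ ^ 2 + 4 / l * ‖Δ‖ ^ 2) +
        β ^ 2 * (2 * (C ^ 2 * ‖e‖ ^ 2) + 2 * ‖Δ‖ ^ 2) := by
        have := mul_le_mul_of_nonneg_left h5 hβ
        have := mul_le_mul_of_nonneg_left hg (by positivity : 0 ≤ 2 * β)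
        have := mul_le_mul_of_nonneg_left h2 (sq_nonneg β)
        linarith
    _ = (1 - 3 * l * β / 4) * ‖e‖ ^ 2 + 8 * C ^ 2 * β * (β * ‖e‖ ^ 2) / 4 +
        2 * β * (2 / l + β) * ‖Δ‖ ^ 2 := by ring
    _ ≤ _ := by linarith

/-- The noise contributes 72β(2/l + β)(K/N)(C²x + Eq). The batch condition bounds (2/l + β)C²K/N by
l/192, so the x-part is (3/8)lβx and 1/2 - 3/8 = 1/8 of the contraction remains. For the q-part, βl
≤ 1/2 gives 2/l + β ≤ (5/2)/l, hence the coefficient 180, below the 240 = 1920/8 available. -/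
theorem contraction_of_batch {l β C K E N q x y I : ℝ} (hl : 0 < l) (hβ : 0 < β) (hK : 1 ≤ K)
    (hE : 0 ≤ E) (hN : 0 < N) (hq : 0 ≤ q) (hx : 0 ≤ x) (hβl : β * l ≤ 1 / 2)
    (hNC : (2 / l + 2 * β) * (192 * C ^ 2 * K / l) ≤ N) (hI : I ≤ 3 * (C ^ 2 * x + E * q))
    (hy : y ≤ (1 - l * β / 2) * x + 2 * β * (2 / l + β) * ((1 / N) ^ 2 * (12 * K * N * I))) :
    y ≤ (1 - l / 8 * β) * x + l / 8 * β * (1920 * E * K / l ^ 2 / N * q) := by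
  have h1 : (2 / l + β) * C ^ 2 * K / N ≤ l / 192 := by
    rw [div_le_div_iff₀ hN (by norm_num)]
    have h2 : (2 / l + β) * C ^ 2 * K * 192 ≤ (2 / l + 2 * β) * C ^ 2 * K * 192 := by
      gcongr; linarith
    have h3 : (2 / l + 2 * β) * C ^ 2 * K * 192 =
        l * ((2 / l + 2 * β) * (192 * C ^ 2 * K / l)) := by field_simp
    have h4 := mul_le_mul_of_nonneg_left hNC hl.le
    linarith
  have h5 : 2 / l + β ≤ 5 / 2 / l := by
    rw [le_div_iff₀ hl, add_mul, div_mul_cancel₀ _ hl.ne']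
    linarith
  have h6 : y ≤ (1 - l * β / 2) * x + 72 * β * ((2 / l + β) * C ^ 2 * K / N) * x +
      72 * β * ((2 / l + β) * (K / N * E * q)) := by
    refine hy.trans ?_
    have h7 : 2 * β * (2 / l + β) * ((1 / N) ^ 2 * (12 * K * N * I)) ≤
        2 * β * (2 / l + β) * ((1 / N) ^ 2 * (12 * K * N * (3 * (C ^ 2 * x + E * q)))) := by
      gcongr
    have h8 : 2 * β * (2 / l + β) * ((1 / N) ^ 2 * (12 * K * N * (3 * (C ^ 2 * x + E * q)))) =
        72 * β * ((2 / l + β) * C ^ 2 * K / N) * x +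
          72 * β * ((2 / l + β) * (K / N * E * q)) := by
      field_simp
      ring
    linarith
  have h9 : 72 * β * ((2 / l + β) * C ^ 2 * K / N) * x ≤ 72 * β * (l / 192) * x := by gcongr
  have h10 : 72 * β * ((2 / l + β) * (K / N * E * q)) ≤
      72 * β * (5 / 2 / l * (K / N * E * q)) := by gcongr
  have h11 : 72 * β * (5 / 2 / l * (K / N * E * q)) ≤
      l / 8 * β * (1920 * E * K / l ^ 2 / N * q) := by
    have h12 : l / 8 * β * (1920 * E * K / l ^ 2 / N * q) = 240 * (β / l * (K / N * E * q)) := by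
      field_simp
      ring
    have h13 : 72 * β * (5 / 2 / l * (K / N * E * q)) = 180 * (β / l * (K / N * E * q)) := by
      field_simp
      ring
    have : 0 ≤ β / l * (K / N * E * q) := by positivity
    linarith
  linarith

namespace MultiAgentMDP

variable {M d : ℕ} {S A Ω : Type*} [MeasurableSpace S] [MeasurableSpace A] [MeasurableSpace Ω]
  {mdp : MultiAgentMDP M d S A Ω} {Ω₀ : Type*} {m₀ : MeasurableSpace Ω₀} {𝓕 : Filtration ℕ m₀}
  {ω : Ω₀ → Ω} {s : ℕ → Ω₀ → S} {a : ℕ → Ω₀ → A} {Q : Measure Ω₀} {μ : Ω → Measure S}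
  {κ ρ Rmax lamPhi γ β : ℝ} {W : Matrix (Fin M) (Fin M) ℝ} {Nc Tc : ℕ}
  {θinit : EuclideanSpace ℝ (Fin d)}

theorem Assumptions.norm_sq_step_le (hμ : mdp.Assumptions μ κ ρ Rmax lamPhi)
    (hM : 0 < M) (hγ : 0 ≤ γ) (hγ1 : γ < 1) (hlam : 0 < lamPhi) (hβ0 : 0 ≤ β)
    (hβC : 8 * CB γ ^ 2 * β ≤ lamB γ lamPhi) (hW : W ∈ doublyStochastic ℝ (Fin M))
    (hN : 0 < Nc) {t : ℕ} (ht : t < Tc) (w : Ω) (s : ℕ → S) (a : ℕ → A) :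
    ‖mdp.meanCritic γ W β Nc Tc θinit s a (t + 1) - mdp.optimalCritic γ (μ w) w‖ ^ 2 ≤
      (1 - lamB γ lamPhi * β / 2) *
        ‖mdp.meanCritic γ W β Nc Tc θinit s a t - mdp.optimalCritic γ (μ w) w‖ ^ 2 +
      2 * β * (2 / lamB γ lamPhi + β) * ((1 / (Nc : ℝ)) ^ 2 *
        ‖∑ i ∈ Finset.range Nc, (mdp.tdField γ (mdp.meanCritic γ W β Nc Tc θinit s a t)
          (s (t * Nc + i), a (t * Nc + i), s (t * Nc + i + 1)) -
            mdp.meanField γ μ w (mdp.meanCritic γ W β Nc Tc θinit s a t))‖ ^ 2) := by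
  have hN' : (Nc : ℝ) ≠ 0 := by exact_mod_cast hN.ne'
  set θ := mdp.meanCritic γ W β Nc Tc θinit s a t
  set θs := mdp.optimalCritic γ (μ w) w
  set Y := ∑ i ∈ Finset.range Nc, (mdp.tdField γ θ
    (s (t * Nc + i), a (t * Nc + i), s (t * Nc + i + 1)) - mdp.meanField γ μ w θ) with hY
  have h0 : mdp.meanField γ μ w θs = 0 := hμ.meanField_optimalCritic hM hγ hγ1 hlam w
  -- The batch mean is the stationary field at the current iterate plus the average of the centred
  -- noises.
  have h1 : mdp.meanCritic γ W β Nc Tc θinit s a (t + 1) - θs =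
      (θ - θs) + β • (mdp.meanField γ μ w θ + (1 / (Nc : ℝ)) • Y) := by
    have hc : (1 / (Nc : ℝ)) • Nc • mdp.meanField γ μ w θ = mdp.meanField γ μ w θ := by
      rw [← Nat.cast_smul_eq_nsmul ℝ, smul_smul, one_div_mul_cancel hN', one_smul]
    rw [meanCritic_succ_of_lt hW ht, Finset.sum_Ico_eq_sum_range,
      show (t + 1) * Nc - t * Nc = Nc by rw [Nat.add_mul, one_mul, Nat.add_sub_cancel_left],
      hY, Finset.sum_sub_distrib, Finset.sum_const, Finset.card_range, smul_sub, hc,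
      add_sub_cancel, smul_smul, mul_one_div]
    abel
  have h2 := hμ.inner_meanField_sub_le hM hγ hγ1 w θ θs
  have h3 := hμ.norm_meanField_sub_le hM hγ w θ θs
  rw [h0, sub_zero] at h2 h3
  rw [h1]
  refine (norm_sq_add_smul_le (lamB_pos hγ1 hlam) hβ0 hβC h2 h3).trans_eq ?_
  rw [norm_smul, mul_pow, Real.norm_of_nonneg (by positivity)]

/-- The mean squared error of the averaged critic. -/
theorem IsPath.integral_norm_sq_meanCritic_sub_le [IsFiniteMeasure Q]
    (h : mdp.IsPath Q 𝓕 ω s a) (hμ : mdp.Assumptions μ κ ρ Rmax lamPhi)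
    (hM : 0 < M) (hγ : 0 ≤ γ) (hγ1 : γ < 1) (hlam : 0 < lamPhi) (hR : 0 ≤ Rmax)
    (hκ : 0 < κ) (hρ0 : 0 < ρ) (hρ1 : ρ < 1) (hβ0 : 0 < β)
    (hβC : 8 * CB γ ^ 2 * β ≤ lamB γ lamPhi) (hW : W ∈ doublyStochastic ℝ (Fin M))
    (hN : 0 < Nc) (hNc : batchMin γ κ ρ lamPhi β ≤ Nc) (hβl : β * lamB γ lamPhi ≤ 1 / 2)
    {t : ℕ} (ht : t ≤ Tc) :
    ∫ x, ‖mdp.meanCritic γ W β Nc Tc θinit (fun i => s i x) (fun i => a i x) t -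
        mdp.optimalCritic γ (μ (ω x)) (ω x)‖ ^ 2 ∂Q ≤
      (c3 γ lamPhi Rmax ‖θinit‖ * (1 - lamB γ lamPhi / 8 * β) ^ t +
        c1 γ κ ρ lamPhi Rmax / Nc) * Q.real Set.univ := by
  have hl := lamB_pos hγ1 hlam
  have hCB : 0 ≤ CB γ := by unfold CB; linarith
  have hK := one_le_mixFactor hκ hρ0 hρ1
  have hN' : (0 : ℝ) < Nc := by exact_mod_cast hN
  have hRθ : 0 ≤ Rtheta γ lamPhi Rmax := by unfold Rtheta; positivity
  have hq : 0 ≤ Q.real Set.univ := measureReal_nonneg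
  set Rθ := Rtheta γ lamPhi Rmax with hRθdef
  set l := lamB γ lamPhi with hldef
  have hc1 : 0 ≤ c1 γ κ ρ lamPhi Rmax / Nc := by rw [c1_eq]; positivity
  have hr : 0 ≤ 1 - l / 8 * β := by linarith
  have hs := h.measurable_state'
  have ha := h.measurable_action'
  have hω := h.measurable_param'
  have hopt : Measurable fun x => mdp.optimalCritic γ (μ (ω x)) (ω x) :=
    (hμ.measurable_optimalCritic hρ0 hρ1 γ).comp hω
  have hoptb : ∀ x, ‖mdp.optimalCritic γ (μ (ω x)) (ω x)‖ ≤ Rθ := fun x =>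
    hμ.norm_optimalCritic_le hM hγ hγ1 hlam hR (ω x)
  set θ : ℕ → Ω₀ → EuclideanSpace ℝ (Fin d) := fun t x =>
    mdp.meanCritic γ W β Nc Tc θinit (fun i => s i x) (fun i => a i x) t with hθ
  set e : ℕ → Ω₀ → EuclideanSpace ℝ (Fin d) := fun t x =>
    θ t x - mdp.optimalCritic γ (μ (ω x)) (ω x) with he
  change ∫ x, ‖e t x‖ ^ 2 ∂Q ≤ _
  have hθm : ∀ t, Measurable (θ t) := fun t =>
    measurable_meanCritic t (fun i _ => hs i) (fun i _ => ha i)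
  have hem : ∀ t, Measurable (e t) := fun t => (hθm t).sub hopt
  have hθb : ∀ t, ∃ b, 0 ≤ b ∧ ∀ x, ‖θ t x‖ ≤ b := fun t => by
    obtain ⟨b, hb0, hb⟩ := exists_norm_critic_le (mdp := mdp) (W := W) (Nc := Nc) (Tc := Tc)
      (θinit := θinit) hμ.reward_nonneg hμ.reward_le hR hγ hμ.feature_norm_le hβ0.le t
    exact ⟨b, hb0, fun x => norm_meanCritic_le hM (hb _ _)⟩
  have hei : ∀ t, Integrable (fun x => ‖e t x‖ ^ 2) Q := fun t => by
    obtain ⟨b, hb0, hb⟩ := hθb t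
    refine Integrable.of_bound (C := (b + Rθ) ^ 2)
      ((hem t).norm.pow_const 2).aestronglyMeasurable (.of_forall fun x => ?_)
    rw [Real.norm_of_nonneg (by positivity)]
    exact pow_le_pow_left₀ (norm_nonneg _)
      ((norm_sub_le _ _).trans (add_le_add (hb x) (hoptb x))) 2
  induction t with
  | zero =>
    have h0 : ∀ x, ‖e 0 x‖ ^ 2 ≤ c3 γ lamPhi Rmax ‖θinit‖ := fun x => by
      simp only [he, hθ, meanCritic_zero hM, c3]
      have h1 := norm_sub_le θinit (mdp.optimalCritic γ (μ (ω x)) (ω x))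
      have h2 := hoptb x
      calc _ ≤ (‖θinit‖ + Rθ) ^ 2 := by gcongr; linarith
        _ ≤ _ := by nlinarith [sq_nonneg (‖θinit‖ - Rθ)]
    calc ∫ x, ‖e 0 x‖ ^ 2 ∂Q ≤ ∫ _x, c3 γ lamPhi Rmax ‖θinit‖ ∂Q :=
          integral_mono (hei 0) (integrable_const _) h0
      _ = c3 γ lamPhi Rmax ‖θinit‖ * Q.real Set.univ := by simp [mul_comm]
      _ ≤ _ := by
          gcongr
          simpa using hc1
  | succ t ih =>
    have ih := ih (Nat.le_of_succ_le ht)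
    obtain ⟨b, hb0, hb⟩ := hθb t
    -- The iterate is known when its batch begins, so the covariance estimates apply with it as a
    -- frozen parameter.
    have hθF : Measurable[𝓕 (t * Nc)] (θ t) :=
      measurable_meanCritic (mX := 𝓕 (t * Nc)) t
        (fun i hi => (h.measurable_state i).mono (𝓕.mono hi) le_rfl)
        (fun i hi => (h.measurable_action i).mono (𝓕.mono hi) le_rfl)
    have hbatch := h.integral_norm_sq_batch_le hμ hM hγ hR hκ hρ0 hρ1 hθF hb Nc
    set Y : Ω₀ → EuclideanSpace ℝ (Fin d) := fun x => ∑ i ∈ Finset.range Nc,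
      (mdp.tdField γ (θ t x) (s (t * Nc + i) x, a (t * Nc + i) x, s (t * Nc + i + 1) x) -
        mdp.meanField γ μ (ω x) (θ t x)) with hY
    have hYm : Measurable Y := Finset.measurable_sum _ fun i _ =>
      ((mdp.measurable_tdField γ).comp
        ((hθm t).prodMk ((hs _).prodMk ((ha _).prodMk (hs _))))).sub
        ((hμ.measurable_meanField hρ0 hρ1 γ).comp ((hθm t).prodMk hω))
    have hYi : Integrable (fun x => ‖Y x‖ ^ 2) Q := by
      refine Integrable.of_bound (C := (Nc * (2 * (CB γ * b + Rmax))) ^ 2)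
        (hYm.norm.pow_const 2).aestronglyMeasurable (.of_forall fun x => ?_)
      rw [Real.norm_of_nonneg (by positivity)]
      refine pow_le_pow_left₀ (norm_nonneg _) ((norm_sum_le_of_le _ fun i _ =>
        (hμ.norm_tdField_sub_meanField_le hM hγ _ _ _).trans
          (show _ ≤ 2 * (CB γ * b + Rmax) by gcongr; exact hb x)).trans_eq ?_) 2
      simp
    have hLi : Integrable (fun x => (CB γ * ‖θ t x‖ + Rmax) ^ 2) Q := by
      refine Integrable.of_bound (C := (CB γ * b + Rmax) ^ 2) (Measurable.aestronglyMeasurable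
        ((((hθm t).norm.const_mul _).add_const _).pow_const 2)) (.of_forall fun x => ?_)
      rw [Real.norm_of_nonneg (by positivity)]
      gcongr
      exact hb x
    -- From ‖θ‖ ≤ ‖e‖ + R_θ and (a + b + c)² ≤ 3(a² + b² + c²); the ‖e‖² part is the feedback
    -- absorbed by the batch size.
    have hL : ∫ x, (CB γ * ‖θ t x‖ + Rmax) ^ 2 ∂Q ≤
        3 * (CB γ ^ 2 * ∫ x, ‖e t x‖ ^ 2 ∂Q +
          (CB γ ^ 2 * Rθ ^ 2 + Rmax ^ 2) * Q.real Set.univ) := by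
      have hpt : ∀ x, (CB γ * ‖θ t x‖ + Rmax) ^ 2 ≤
          3 * CB γ ^ 2 * ‖e t x‖ ^ 2 + 3 * (CB γ ^ 2 * Rθ ^ 2 + Rmax ^ 2) := fun x => by
        have h1 : ‖θ t x‖ ≤ ‖e t x‖ + Rθ := by
          have := norm_add_le (e t x) (mdp.optimalCritic γ (μ (ω x)) (ω x))
          simp only [he, sub_add_cancel] at this ⊢
          linarith [hoptb x]
        calc (CB γ * ‖θ t x‖ + Rmax) ^ 2 ≤ (CB γ * (‖e t x‖ + Rθ) + Rmax) ^ 2 := by gcongr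
          _ ≤ _ := by
            nlinarith [sq_nonneg (CB γ * ‖e t x‖ - CB γ * Rθ), sq_nonneg (CB γ * ‖e t x‖ - Rmax),
              sq_nonneg (CB γ * Rθ - Rmax)]
      have := integral_mono hLi (((hei t).const_mul _).add (integrable_const _)) hpt
      rw [integral_add' ((hei t).const_mul _) (integrable_const _), integral_const_mul,
        integral_const, smul_eq_mul] at this
      linarith
    have hstep : ∫ x, ‖e (t + 1) x‖ ^ 2 ∂Q ≤ (1 - l * β / 2) * ∫ x, ‖e t x‖ ^ 2 ∂Q +
        2 * β * (2 / l + β) * ((1 / (Nc : ℝ)) ^ 2 * ∫ x, ‖Y x‖ ^ 2 ∂Q) := by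
      rw [← integral_const_mul, ← integral_const_mul, ← integral_const_mul,
        ← integral_add ((hei t).const_mul _) ((hYi.const_mul _).const_mul _)]
      exact integral_mono (hei (t + 1)) (((hei t).const_mul _).add
        ((hYi.const_mul _).const_mul _)) fun x =>
          hμ.norm_sq_step_le hM hγ hγ1 hlam hβ0.le hβC hW hN ht (ω x) _ _
    have hstep' := hstep.trans (add_le_add_right (mul_le_mul_of_nonneg_left
      (mul_le_mul_of_nonneg_left hbatch (by positivity : 0 ≤ (1 / (Nc : ℝ)) ^ 2))
      (by positivity : 0 ≤ 2 * β * (2 / l + β))) _)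
    rw [batchMin_eq] at hNc
    have hcon := contraction_of_batch hl hβ0 hK (by positivity) hN' hq
      (integral_nonneg fun x => by positivity) hβl hNc hL hstep'
    rw [← c1_eq] at hcon
    -- The recursion is a convex combination of the previous error and the floor c₁/N_c, so the
    -- floor is preserved and only the c₃ term decays.
    calc _ ≤ _ := hcon
      _ ≤ (1 - l / 8 * β) * ((c3 γ lamPhi Rmax ‖θinit‖ * (1 - l / 8 * β) ^ t +
            c1 γ κ ρ lamPhi Rmax / Nc) * Q.real Set.univ) +
          l / 8 * β * (c1 γ κ ρ lamPhi Rmax / Nc * Q.real Set.univ) := by gcongr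
      _ = _ := by ring

theorem measurable_sqError (h : mdp.IsPath Q 𝓕 ω s a) (hμ : mdp.Assumptions μ κ ρ Rmax lamPhi)
    (hρ0 : 0 < ρ) (hρ1 : ρ < 1) (Tc' : ℕ) (m : Fin M) :
    Measurable (mdp.sqError γ μ W β Nc Tc Tc' θinit ω s a m) := by
  have h1 := measurable_critic (mdp := mdp) (γ := γ) (β := β) (W := W) (Nc := Nc) (Tc := Tc)
    (θinit := θinit) (Tc + Tc') (fun i _ => h.measurable_state' i)
    (fun i _ => h.measurable_action' i) m
  exact (h1.sub ((hμ.measurable_optimalCritic hρ0 hρ1 γ).comp h.measurable_param')).norm.pow_const 2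

theorem integrable_sqError [IsFiniteMeasure Q] (h : mdp.IsPath Q 𝓕 ω s a)
    (hμ : mdp.Assumptions μ κ ρ Rmax lamPhi)
    (hM : 0 < M) (hγ : 0 ≤ γ) (hγ1 : γ < 1) (hlam : 0 < lamPhi) (hR : 0 ≤ Rmax)
    (hρ0 : 0 < ρ) (hρ1 : ρ < 1) (hβ0 : 0 ≤ β) (Tc' : ℕ) (m : Fin M) :
    Integrable (mdp.sqError γ μ W β Nc Tc Tc' θinit ω s a m) Q := by
  obtain ⟨b, hb0, hb⟩ := exists_norm_critic_le (mdp := mdp) (W := W) (Nc := Nc) (Tc := Tc)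
    (θinit := θinit) hμ.reward_nonneg hμ.reward_le hR hγ hμ.feature_norm_le hβ0 (Tc + Tc')
  refine Integrable.of_bound (C := (b + Rtheta γ lamPhi Rmax) ^ 2)
    (measurable_sqError h hμ hρ0 hρ1 Tc' m).aestronglyMeasurable (.of_forall fun x => ?_)
  rw [sqError, Real.norm_of_nonneg (by positivity)]
  exact pow_le_pow_left₀ (norm_nonneg _) ((norm_sub_le _ _).trans
    (add_le_add (hb _ _ m) (hμ.norm_optimalCritic_le hM hγ hγ1 hlam hR (ω x)))) 2

/-- Pure mixing does not move the average, so the reference point is the averaged critic at time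
`Tc`; the two factors 2 come from ‖x + y‖² ≤ 2‖x‖² + 2‖y‖². -/
theorem Assumptions.sum_sqError_le (hμ : mdp.Assumptions μ κ ρ Rmax lamPhi)
    (hM : 0 < M) (hγ : 0 ≤ γ) (hR : 0 ≤ Rmax) (hβ0 : 0 ≤ β)
    (hW : W ∈ doublyStochastic ℝ (Fin M)) (hσ : sigmaW W < 1)
    (hβσ : β * CB γ ≤ (1 - sigmaW W) / 2) (Tc' : ℕ) (x : Ω₀) :
    ∑ m, mdp.sqError γ μ W β Nc Tc Tc' θinit ω s a m x ≤
      sigmaW W ^ (2 * Tc') * β ^ 2 * c2 M (sigmaW W) Rmax +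
        2 * M * ‖mdp.meanCritic γ W β Nc Tc θinit (fun i => s i x) (fun i => a i x) Tc -
          mdp.optimalCritic γ (μ (ω x)) (ω x)‖ ^ 2 := by
  have h1 := sum_norm_sq_critic_sub_meanCritic_le (mdp := mdp) (W := W) (Nc := Nc) (Tc := Tc)
    (θinit := θinit) (s := fun i => s i x) (a := fun i => a i x) hM hμ.reward_nonneg hμ.reward_le
    hγ hμ.feature_norm_le hβ0 hR hW hσ hβσ Tc'
  refine le_trans ?_ (add_le_add_left h1 _)
  rw [Finset.mul_sum]
  have h2 : (2 * M : ℝ) * ‖mdp.meanCritic γ W β Nc Tc θinit (fun i => s i x) (fun i => a i x) Tc -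
      mdp.optimalCritic γ (μ (ω x)) (ω x)‖ ^ 2 = ∑ _m : Fin M,
      2 * ‖mdp.meanCritic γ W β Nc Tc θinit (fun i => s i x) (fun i => a i x) Tc -
        mdp.optimalCritic γ (μ (ω x)) (ω x)‖ ^ 2 := by
    simp
    ring
  rw [h2, ← Finset.sum_add_distrib]
  refine Finset.sum_le_sum fun m _ => ?_
  rw [sqError]
  set p := mdp.critic γ W β Nc Tc θinit (fun i => s i x) (fun i => a i x) (Tc + Tc') m
  set q := mdp.meanCritic γ W β Nc Tc θinit (fun i => s i x) (fun i => a i x) Tc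
  set r := mdp.optimalCritic γ (μ (ω x)) (ω x)
  have h3 := norm_sub_le_norm_sub_add_norm_sub p q r
  calc ‖p - r‖ ^ 2 ≤ (‖p - q‖ + ‖q - r‖) ^ 2 := pow_le_pow_left₀ (norm_nonneg _) h3 2
    _ ≤ _ := by nlinarith [sq_nonneg (‖p - q‖ - ‖q - r‖)]

end MultiAgentMDP

/-! ### From integrals to conditional expectations, and the growth of the tuning parameters. -/

theorem condExp_le_const_of_setIntegral_le {X : Type*} {m m₀ : MeasurableSpace X}
    {P : Measure X} [IsFiniteMeasure P] (hm : m ≤ m₀) {f : X → ℝ} (hf : Integrable f P) {B : ℝ}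
    (h : ∀ F, MeasurableSet[m] F → ∫ x in F, f x ∂P ≤ B * P.real F) :
    P[f | m] ≤ᵐ[P] fun _ => B := by
  refine ae_le_of_ae_le_trim (hm := hm) (ae_le_of_forall_setIntegral_le
    (integrable_condExp.trim hm stronglyMeasurable_condExp) (integrable_const _)
    fun F hF _ => ?_)
  rw [← setIntegral_trim hm stronglyMeasurable_condExp hF, setIntegral_condExp hm hf hF,
    setIntegral_const, smul_eq_mul, measureReal_def, trim_measurableSet_eq hm hF, mul_comm]
  exact h F hF

/-- The number of iterations of a linearly convergent method is logarithmic in the accuracy. -/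
theorem exists_nat_isBigO_log {q A : ℝ} (hq0 : 0 ≤ q) (hq1 : q < 1) :
    ∃ T : ℝ → ℕ, ((fun ε => (T ε : ℝ)) =O[𝓝[>] 0] fun ε => Real.log ε⁻¹) ∧
      ∀ ε : ℝ, 0 < ε → A * q ^ T ε ≤ ε := by
  -- Enlarging q to be positive and A to be at least 1 keeps both logarithms meaningful, also when q
  -- = 0.
  set r := max q (1 / 2) with hr
  set C := max A 1 with hC
  have hr0 : 0 < r := lt_max_of_lt_right (by norm_num)
  have hr1 : r < 1 := max_lt hq1 (by norm_num)
  have hC1 : 1 ≤ C := le_max_right _ _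
  have hC0 : 0 < C := by linarith
  set L := Real.log r⁻¹ with hL
  have hL0 : 0 < L := Real.log_pos ((one_lt_inv₀ hr0).2 hr1)
  refine ⟨fun ε => ⌈Real.log (C * ε⁻¹) / L⌉₊, ?_, fun ε hε => ?_⟩
  · refine Asymptotics.IsBigO.of_bound ((Real.log C + 1) / L + 1) ?_
    -- Below e⁻¹ one has log ε⁻¹ ≥ 1, which absorbs the additive constants.
    have hmem : Set.Ioo (0 : ℝ) (Real.exp (-1)) ∈ 𝓝[>] (0 : ℝ) :=
      Ioo_mem_nhdsGT (Real.exp_pos _)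
    filter_upwards [hmem] with ε hε
    have h1 : 1 ≤ Real.log ε⁻¹ := by
      rw [Real.log_inv]
      have := (Real.log_lt_iff_lt_exp hε.1).2 hε.2
      linarith
    have hlogC : 0 ≤ Real.log C := Real.log_nonneg hC1
    have h2 : Real.log (C * ε⁻¹) = Real.log C + Real.log ε⁻¹ :=
      Real.log_mul hC0.ne' (inv_ne_zero hε.1.ne')
    rw [Real.norm_of_nonneg (Nat.cast_nonneg _), Real.norm_of_nonneg (by linarith)]
    refine (Nat.ceil_lt_add_one (by rw [h2]; positivity)).le.trans ?_
    rw [h2, add_mul, one_mul, div_mul_eq_mul_div]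
    gcongr
    nlinarith
  · have h1 : Real.log (C * ε⁻¹) ≤ ⌈Real.log (C * ε⁻¹) / L⌉₊ * L :=
      (div_le_iff₀ hL0).1 (Nat.le_ceil _)
    set n := ⌈Real.log (C * ε⁻¹) / L⌉₊
    have h2 : C * ε⁻¹ ≤ (r ^ n)⁻¹ := by
      rw [← Real.log_le_log_iff (by positivity) (by positivity), ← inv_pow, Real.log_pow]
      exact h1
    calc A * q ^ n ≤ C * r ^ n := by
          gcongr
          · exact le_max_left _ _
          · exact le_max_left _ _
      _ = C * ε⁻¹ * r ^ n * ε := by field_simp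
      _ ≤ (r ^ n)⁻¹ * r ^ n * ε := by gcongr
      _ = ε := by rw [inv_mul_cancel₀ (by positivity), one_mul]

/-- A batch size above a fixed threshold and proportional to the inverse accuracy. -/
theorem exists_nat_isBigO_inv {n₀ A : ℝ} (hA : 0 ≤ A) (hn₀ : 0 < n₀) :
    ∃ N : ℝ → ℕ, ((fun ε => (N ε : ℝ)) =O[𝓝[>] 0] fun ε => ε⁻¹) ∧
      ∀ ε : ℝ, 0 < ε → n₀ ≤ N ε ∧ A / N ε ≤ ε := by
  refine ⟨fun ε => ⌈n₀ + A * ε⁻¹⌉₊, ?_, fun ε hε => ?_⟩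
  · refine Asymptotics.IsBigO.of_bound (n₀ + A + 1) ?_
    filter_upwards [Ioo_mem_nhdsGT (zero_lt_one' ℝ)] with ε hε
    have h1 : 1 ≤ ε⁻¹ := (one_le_inv₀ hε.1).2 hε.2.le
    have h0 : 0 ≤ A * ε⁻¹ := by have := hε.1; positivity
    rw [Real.norm_of_nonneg (Nat.cast_nonneg _), Real.norm_of_nonneg (by linarith)]
    refine (Nat.ceil_lt_add_one (by positivity)).le.trans ?_
    nlinarith
  · have h1 := Nat.le_ceil (n₀ + A * ε⁻¹)
    have h0 : 0 ≤ A * ε⁻¹ := by positivity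
    refine ⟨by linarith, ?_⟩
    rw [div_le_iff₀ (by linarith), ← div_le_iff₀' hε, div_eq_mul_inv]
    linarith

/-! ### Assembly of the finite-time bound. -/

namespace MultiAgentMDP

variable {M d : ℕ} {S A Ω : Type*} [MeasurableSpace S] [MeasurableSpace A] [MeasurableSpace Ω]
  {mdp : MultiAgentMDP M d S A Ω} {Ω₀ : Type*} {m₀ : MeasurableSpace Ω₀} {𝓕 : Filtration ℕ m₀}
  {ω : Ω₀ → Ω} {s : ℕ → Ω₀ → S} {a : ℕ → Ω₀ → A} {μ : Ω → Measure S}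
  {κ ρ Rmax lamPhi γ β : ℝ} {W : Matrix (Fin M) (Fin M) ℝ} {Nc Tc Tc' : ℕ}
  {θinit : EuclideanSpace ℝ (Fin d)}

/-- 8C_B²βλ_B ≤ λ_B² ≤ 4C_B². This sharpens the bound βλ_B ≤ 4 contained in `betaMax`, but needs a
nonzero vector. -/
theorem Assumptions.mul_lamB_le (hμ : mdp.Assumptions μ κ ρ Rmax lamPhi) (hM : 0 < M)
    (hγ : 0 ≤ γ) (hγ1 : γ < 1) (hlam : 0 < lamPhi)
    (hβC : 8 * CB γ ^ 2 * β ≤ lamB γ lamPhi) (w : Ω) {v : EuclideanSpace ℝ (Fin d)}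
    (hv : v ≠ 0) : β * lamB γ lamPhi ≤ 1 / 2 := by
  have h1 := hμ.lamB_le hM hγ hγ1 w hv
  have hl := lamB_pos hγ1 hlam
  have hC : 0 < CB γ := by unfold CB; linarith
  have h2 := mul_le_mul_of_nonneg_right hβC hl.le
  have h3 : lamB γ lamPhi * lamB γ lamPhi ≤ (2 * CB γ) * (2 * CB γ) :=
    mul_le_mul h1 h1 hl.le (by positivity)
  have h4 : 0 < 8 * CB γ ^ 2 := by positivity
  refine le_of_mul_le_mul_left ?_ h4
  nlinarith

/-- The finite-time error bound of decentralized temporal-difference learning. -/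
theorem IsMarkovianSample.condExp_sum_sqError_le {Pr : Measure Ω₀} [IsFiniteMeasure Pr]
    (h : mdp.IsMarkovianSample Pr 𝓕 ω s a) (hμ : mdp.Assumptions μ κ ρ Rmax lamPhi)
    (hM : 0 < M) (hγ : 0 ≤ γ) (hγ1 : γ < 1) (hκ : 0 < κ) (hρ0 : 0 < ρ) (hρ1 : ρ < 1)
    (hR : 0 ≤ Rmax) (hlam : 0 < lamPhi) (hW : W ∈ doublyStochastic ℝ (Fin M))
    (hσ : sigmaW W < 1) (hβ0 : 0 < β) (hβ : β ≤ betaMax γ lamPhi (sigmaW W))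
    (hNc : batchMin γ κ ρ lamPhi β ≤ Nc) :
    (∀ m, Integrable (mdp.sqError γ μ W β Nc Tc Tc' θinit ω s a m) Pr) ∧
      (fun x => ∑ m, (Pr[mdp.sqError γ μ W β Nc Tc Tc' θinit ω s a m |
        MeasurableSpace.comap ω inferInstance]) x) ≤ᵐ[Pr] fun _ =>
          sigmaW W ^ (2 * Tc') * β ^ 2 * c2 M (sigmaW W) Rmax +
            2 * M * (c3 γ lamPhi Rmax ‖θinit‖ * (1 - lamB γ lamPhi / 8 * β) ^ Tc +
              c1 γ κ ρ lamPhi Rmax / Nc) := by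
  have hl := lamB_pos hγ1 hlam
  have hC : 0 < CB γ := by unfold CB; linarith
  have hK := one_le_mixFactor hκ hρ0 hρ1
  have hβ1 : β ≤ lamB γ lamPhi / (8 * CB γ ^ 2) := hβ.trans (min_le_left _ _)
  have hβ2 : β ≤ 4 / lamB γ lamPhi := hβ.trans ((min_le_right _ _).trans (min_le_left _ _))
  have hβ3 : β ≤ (1 - sigmaW W) / (2 * CB γ) :=
    hβ.trans ((min_le_right _ _).trans (min_le_right _ _))
  rw [le_div_iff₀ (by positivity)] at hβ1 hβ2 hβ3
  have hβC : 8 * CB γ ^ 2 * β ≤ lamB γ lamPhi := by linarith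
  have hβσ : β * CB γ ≤ (1 - sigmaW W) / 2 := by linarith
  have hN : 0 < Nc := by
    have h1 : 0 < batchMin γ κ ρ lamPhi β := by
      rw [batchMin_eq]
      positivity
    exact_mod_cast h1.trans_le hNc
  have hr : 0 ≤ 1 - lamB γ lamPhi / 8 * β := by linarith
  have hPr : mdp.IsPath Pr 𝓕 ω s a := by
    simpa using h.isPath_restrict (F₀ := Set.univ) MeasurableSet.univ
  have hint := fun m => integrable_sqError (W := W) (Nc := Nc) (Tc := Tc) (θinit := θinit)
    hPr hμ hM hγ hγ1 hlam hR hρ0 hρ1 hβ0.le Tc' m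
  refine ⟨hint, ?_⟩
  have hcomap : MeasurableSpace.comap ω inferInstance ≤ 𝓕 0 := h.measurable_param.comap_le
  have hsum := condExp_finsetSum (μ := Pr) (s := Finset.univ)
    (f := fun m => mdp.sqError γ μ W β Nc Tc Tc' θinit ω s a m) (fun m _ => hint m)
    (MeasurableSpace.comap ω inferInstance)
  have hle := condExp_le_const_of_setIntegral_le (hcomap.trans (𝓕.le 0))
    (f := ∑ m, mdp.sqError γ μ W β Nc Tc Tc' θinit ω s a m)
    (integrable_finsetSum' _ fun m _ => hint m)
    (B := sigmaW W ^ (2 * Tc') * β ^ 2 * c2 M (sigmaW W) Rmax +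
            2 * M * (c3 γ lamPhi Rmax ‖θinit‖ * (1 - lamB γ lamPhi / 8 * β) ^ Tc +
              c1 γ κ ρ lamPhi Rmax / Nc)) fun F hF => ?_
  · filter_upwards [hsum, hle] with x h1 h2
    rw [h1] at h2
    simpa using h2
  -- Restriction to an arbitrary event of σ(ω) stands in for conditioning on ω.
  set Q := Pr.restrict F with hQ
  have hQp : mdp.IsPath Q 𝓕 ω s a := h.isPath_restrict (hcomap _ hF)
  have hq : Q.real Set.univ = Pr.real F := by simp [hQ]
  set e : Ω₀ → ℝ := fun x =>
    ‖mdp.meanCritic γ W β Nc Tc θinit (fun i => s i x) (fun i => a i x) Tc -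
      mdp.optimalCritic γ (μ (ω x)) (ω x)‖ ^ 2 with he
  have hbound : ∫ x, e x ∂Q ≤ (c3 γ lamPhi Rmax ‖θinit‖ * (1 - lamB γ lamPhi / 8 * β) ^ Tc +
      c1 γ κ ρ lamPhi Rmax / Nc) * Q.real Set.univ := by
    -- If `Ω₀` is empty or `d = 0`, the bound on βλ_B is not available, but the error vanishes
    -- identically.
    by_cases hv : Nonempty Ω₀ ∧ ∃ v : EuclideanSpace ℝ (Fin d), v ≠ 0
    · obtain ⟨⟨x⟩, v, hv⟩ := hv
      exact hQp.integral_norm_sq_meanCritic_sub_le hμ hM hγ hγ1 hlam hR hκ hρ0 hρ1 hβ0 hβC hW hN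
        hNc (hμ.mul_lamB_le hM hγ hγ1 hlam hβC (ω x) hv) le_rfl
    · have h0 : ∀ x, e x = 0 := fun x => by
        refine (pow_eq_zero_iff two_ne_zero).2 (norm_eq_zero.2 ?_)
        exact by_contra fun h1 => hv ⟨⟨x⟩, _, h1⟩
      simp only [h0, integral_zero, c3, c1_eq]
      have : (0 : ℝ) < Nc := by exact_mod_cast hN
      positivity
  have hei : Integrable e Q := by
    have hem : Measurable e := ((measurable_meanCritic Tc (fun i _ => hQp.measurable_state' i)
      (fun i _ => hQp.measurable_action' i)).sub
        ((hμ.measurable_optimalCritic hρ0 hρ1 γ).comp hQp.measurable_param')).norm.pow_const 2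
    obtain ⟨b, hb0, hb⟩ := exists_norm_critic_le (mdp := mdp) (W := W) (Nc := Nc) (Tc := Tc)
      (θinit := θinit) hμ.reward_nonneg hμ.reward_le hR hγ hμ.feature_norm_le hβ0.le Tc
    refine Integrable.of_bound (C := (b + Rtheta γ lamPhi Rmax) ^ 2) hem.aestronglyMeasurable
      (.of_forall fun x => ?_)
    simp only [he]
    rw [Real.norm_of_nonneg (by positivity)]
    exact pow_le_pow_left₀ (norm_nonneg _) ((norm_sub_le _ _).trans
      (add_le_add (norm_meanCritic_le hM (hb _ _))
        (hμ.norm_optimalCritic_le hM hγ hγ1 hlam hR (ω x)))) 2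
  have hQint : Integrable (∑ m, mdp.sqError γ μ W β Nc Tc Tc' θinit ω s a m) Q :=
    (integrable_finsetSum' _ fun m _ => hint m).restrict
  have hmono := integral_mono hQint ((integrable_const _).add (hei.const_mul (2 * M : ℝ)))
    fun x => by
      have := hμ.sum_sqError_le (W := W) (Nc := Nc) (Tc := Tc) (θinit := θinit) (ω := ω) (s := s)
        (a := a) hM hγ hR hβ0.le hW hσ hβσ Tc' x
      simpa only [Finset.sum_apply, Pi.add_apply] using this
  rw [integral_add' (integrable_const _) (hei.const_mul _), integral_const, integral_const_mul,
    smul_eq_mul] at hmono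
  have h2 := mul_le_mul_of_nonneg_left hbound (by positivity : (0 : ℝ) ≤ 2 * M)
  rw [hq] at hmono h2
  linarith

end MultiAgentMDP

end DecTD

end

theorem mainTheorem1 {M d : ℕ} (hM : 0 < M) {S A Ω Ω₀ : Type*} [MeasurableSpace S]
    [MeasurableSpace A] [MeasurableSpace Ω] [m₀ : MeasurableSpace Ω₀]
    (γ κ ρ Rmax lamPhi β : ℝ) (hγ0 : 0 ≤ γ) (hγ1 : γ < 1) (hκ : 0 < κ) (hρ0 : 0 < ρ) (hρ1 : ρ < 1)
    (hR : 0 < Rmax) (hlam : 0 < lamPhi)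
    (W : Matrix (Fin M) (Fin M) ℝ) (hW : W ∈ doublyStochastic ℝ (Fin M))
    (hσ : DecTD.sigmaW W < 1)
    (hβ0 : 0 < β) (hβ : β ≤ DecTD.betaMax γ lamPhi (DecTD.sigmaW W))
    (θinit : EuclideanSpace ℝ (Fin d)) :
    -- the convergence rate
    (∀ (mdp : DecTD.MultiAgentMDP M d S A Ω) (μ : Ω → Measure S),
      mdp.Assumptions μ κ ρ Rmax lamPhi →
      ∀ Nc Tc Tc' : ℕ, DecTD.batchMin γ κ ρ lamPhi β ≤ (Nc : ℝ) →
      ∀ (Pr : Measure Ω₀) [IsProbabilityMeasure Pr] (𝓕 : Filtration ℕ m₀) (ω : Ω₀ → Ω)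
        (s : ℕ → Ω₀ → S) (a : ℕ → Ω₀ → A), mdp.IsMarkovianSample Pr 𝓕 ω s a →
      (∀ m, Integrable (mdp.sqError γ μ W β Nc Tc Tc' θinit ω s a m) Pr) ∧
      (fun x => ∑ m, (Pr[mdp.sqError γ μ W β Nc Tc Tc' θinit ω s a m |
          MeasurableSpace.comap ω inferInstance]) x)
        ≤ᵐ[Pr] fun _ =>
          DecTD.sigmaW W ^ (2 * Tc') * β ^ 2 * DecTD.c2 M (DecTD.sigmaW W) Rmax
            + 2 * M * (DecTD.c3 γ lamPhi Rmax ‖θinit‖ * (1 - DecTD.lamB γ lamPhi / 8 * β) ^ Tc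
              + DecTD.c1 γ κ ρ lamPhi Rmax / Nc)) ∧
    -- the complexity of reaching accuracy `ε`
    (∃ Nc Tc Tc' : ℝ → ℕ,
      ((fun ε => (Nc ε : ℝ)) =O[𝓝[>] 0] fun ε => ε⁻¹) ∧
      ((fun ε => (Tc ε : ℝ)) =O[𝓝[>] 0] fun ε => Real.log ε⁻¹) ∧
      ((fun ε => (Tc' ε : ℝ)) =O[𝓝[>] 0] fun ε => Real.log ε⁻¹) ∧
      ((fun ε => ((Tc ε * Nc ε : ℕ) : ℝ)) =O[𝓝[>] 0] fun ε => ε⁻¹ * Real.log ε⁻¹) ∧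
      ((fun ε => ((Tc ε + Tc' ε : ℕ) : ℝ)) =O[𝓝[>] 0] fun ε => Real.log ε⁻¹) ∧
      ∀ ε : ℝ, 0 < ε → DecTD.batchMin γ κ ρ lamPhi β ≤ (Nc ε : ℝ) ∧
        ∀ (mdp : DecTD.MultiAgentMDP M d S A Ω) (μ : Ω → Measure S),
        mdp.Assumptions μ κ ρ Rmax lamPhi →
        ∀ (Pr : Measure Ω₀) [IsProbabilityMeasure Pr] (𝓕 : Filtration ℕ m₀) (ω : Ω₀ → Ω)
          (s : ℕ → Ω₀ → S) (a : ℕ → Ω₀ → A), mdp.IsMarkovianSample Pr 𝓕 ω s a →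
        (∀ m, Integrable (mdp.sqError γ μ W β (Nc ε) (Tc ε) (Tc' ε) θinit ω s a m) Pr) ∧
        (fun x => ∑ m, (Pr[mdp.sqError γ μ W β (Nc ε) (Tc ε) (Tc' ε) θinit ω s a m |
            MeasurableSpace.comap ω inferInstance]) x)
          ≤ᵐ[Pr] fun _ => ε) := by
  have hl := DecTD.lamB_pos hγ1 hlam
  have hC : 0 < DecTD.CB γ := by unfold DecTD.CB; linarith
  have hK := DecTD.one_le_mixFactor hκ hρ0 hρ1
  have hM' : (0 : ℝ) < M := by exact_mod_cast hM
  have hσ0 : 0 ≤ DecTD.sigmaW W := LinearMap.singularValues_nonneg _ _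
  refine ⟨fun mdp μ hμ Nc Tc Tc' hNc Pr _ 𝓕 ω s a h =>
    h.condExp_sum_sqError_le hμ hM hγ0 hγ1 hκ hρ0 hρ1 hR.le hlam hW hσ hβ0 hβ hNc, ?_⟩
  have hbatch : 0 < DecTD.batchMin γ κ ρ lamPhi β := by
    rw [DecTD.batchMin_eq]
    positivity
  have hc1 : 0 ≤ DecTD.c1 γ κ ρ lamPhi Rmax := by
    rw [DecTD.c1_eq]
    positivity
  have hβ2 : β ≤ 4 / DecTD.lamB γ lamPhi :=
    hβ.trans ((min_le_right _ _).trans (min_le_left _ _))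
  rw [le_div_iff₀ hl] at hβ2
  -- The accuracy is shared out as ε/4 for the noise floor, ε/4 for the transient and ε/2 for the
  -- consensus error; hence the factors 8M, 8M and 2 in the three choices of `A`.
  obtain ⟨Nc, hNcO, hNc⟩ := DecTD.exists_nat_isBigO_inv
    (A := 8 * M * DecTD.c1 γ κ ρ lamPhi Rmax) (by positivity) hbatch
  obtain ⟨Tc, hTcO, hTc⟩ := DecTD.exists_nat_isBigO_log
    (q := 1 - DecTD.lamB γ lamPhi / 8 * β) (A := 8 * M * DecTD.c3 γ lamPhi Rmax ‖θinit‖)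
    (by linarith) (by linarith [mul_pos hl hβ0])
  obtain ⟨Tc', hTcO', hTc'⟩ := DecTD.exists_nat_isBigO_log
    (q := DecTD.sigmaW W ^ 2) (A := 2 * (β ^ 2 * DecTD.c2 M (DecTD.sigmaW W) Rmax))
    (by positivity) (by nlinarith)
  refine ⟨Nc, Tc, Tc', hNcO, hTcO, hTcO', ?_, ?_, fun ε hε => ⟨(hNc ε hε).1, ?_⟩⟩
  · simpa only [Nat.cast_mul, mul_comm] using hNcO.mul hTcO
  · simpa only [Nat.cast_add] using hTcO.add hTcO'
  · intro mdp μ hμ Pr _ 𝓕 ω s a h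
    obtain ⟨h1, h2⟩ := h.condExp_sum_sqError_le (Tc := Tc ε) (Tc' := Tc' ε) (θinit := θinit)
      hμ hM hγ0 hγ1 hκ hρ0 hρ1 hR.le hlam hW hσ hβ0 hβ (hNc ε hε).1
    refine ⟨h1, h2.trans (.of_forall fun x => ?_)⟩
    have h3 := (hNc ε hε).2
    have h4 := hTc ε hε
    have h5 := hTc' ε hε
    rw [← pow_mul] at h5
    rw [mul_div_assoc] at h3
    linarith
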